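/- Let $\bar M$ be a compact connected smooth $3$-manifold with (possibly empty) boundary, and let $M$ be its interior (a tame $3$-manifold); the components of $\partial\bar M$ are the ends of $M$. Let $\hat M$ be obtained from $\bar M$ by collapsing each boundary component to a point (an \emph{ideal point}). Let $\tilde M$ be the interior of the universal cover of $\bar M$, and let $\hat{\tilde M}$ be $\tilde M$ together with one ideal point for each lift of an end, i.e. for each component of the preimage of $\partial\bar M$; its topology is generated by the components of the preimages of the open subsets of $\hat M$. Fix a base point of $\bar M$ and a lift of it, so that $\pi_1(M)=\pi_1(\bar M)$ acts on $\hat{\tilde M}$ through covering transformations. A \emph{triangulation} of $M$ is an identification of $\hat M$ with a finite complex of dimension at most $3$ obtained by gluing simplices along faces by simplicial maps, such that open simplices embed (closed simplices need not) and such that all ideal points are zero-cells. It lifts to $\hat{\tilde M}$; the characteristic maps of the lifted cells are the continuous lifts of the characteristic maps of the cells of $\hat M$. An element of $\mathrm{PSL}(2,\mathbb C)$ is \emph{parabolic} if it fixes exactly one point of $\partial\bar{\mathbb H}^3$. A subgroup is \emph{parabolic} if its elements have a common fixed point in $\partial\bar{\mathbb H}^3$ and its non-identity elements are parabolic. A representation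 $\rho\colon\pi_1(M)\to\mathrm{PSL}(2,\mathbb C)$ is \emph{boundary-parabolic} if it maps every peripheral subgroup (the image of $\pi_1(E)$, for an end $E$, under a path from the base point to $E$) to a parabolic subgroup; an end is \emph{non-trivial} if the image of its peripheral subgroup is non-trivial. A \emph{developing map} of $\rho$ with respect to a triangulation is a $\rho$-equivariant map $D\colon\hat{\tilde M}\to\bar{\mathbb H}^3$ which sends all zero-cells to $\partial\bar{\mathbb H}^3$ and whose composition with the characteristic map of each cell is a homeomorphism onto a non-degenerate ideal simplex (one whose ideal vertices span a hyperbolic simplex of the full dimension of the cell) taking straight segments to hyperbolic straight segments. Two developing maps are \emph{equivalent} if they agree on the ideal points that correspond to lifts of non-trivial ends. \textbf{Theorem.} \begin{enumerate} \item (Existence for sufficiently fine triangulations.) For every triangulation $T$ of $M$ there is an $m$ such that for all $n\ge m$ every boundary-parabolic representation has a developing map with respect to the $n$-th iterated barycentric subdivision of $T$. Moreover, every boundary-parabolic representation has a developing map with respect to any triangulation in which the vertices of each simplex are distinct points of $\hat M$, at most one of them ideal. \item (Uniqueness.) For every triangulation of $M$ and every boundary-parabolic representation $\rho$, any two developing maps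 of $\rho$ are equivalent. \item For every triangulation $T$ of $M$, every boundary-parabolic representation has a developing map with respect to the first barycentric subdivision of $T$; the trivial representation is boundary-parabolic. \end{enumerate} -/

import Mathlib

open scoped Manifold ContDiff MatrixGroups ComplexOrder Matrix

/-! ## Closed hyperbolic 3-space and the action of `PSL(2, ℂ)` -/

/-- Hyperbolic 3-space together with its sphere at infinity, in the projective (Klein) model:
rays of nonzero positive semidefinite Hermitian `2 × 2` matrices, each ray represented by its
element of trace `1`. The determinant is the Lorentz form, so points of hyperbolic space are the
positive definite matrices, points at infinity are the rank one matrices `v vᴴ / |v|²`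
(`v ∈ ℂP¹`), and hyperbolic straight lines are euclidean straight lines. -/
def ClosedHyperbolic3 : Type :=
  {A : Matrix (Fin 2) (Fin 2) ℂ // A.PosSemidef ∧ A.trace = 1}

namespace ClosedHyperbolic3

instance : TopologicalSpace ClosedHyperbolic3 :=
  inferInstanceAs (TopologicalSpace {A : Matrix (Fin 2) (Fin 2) ℂ // A.PosSemidef ∧ A.trace = 1})

/-- The sphere at infinity: the singular (equivalently rank one) matrices. -/
def boundary : Set ClosedHyperbolic3 := {A | A.1.det = 0}

theorem trace_conj_ne_zero (g : SL(2, ℂ)) (A : ClosedHyperbolic3) :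
    (g.1 * A.1 * g.1ᴴ).trace ≠ 0 := by
  intro h
  have h0 := ((A.2.1.mul_mul_conjTranspose_same g.1).trace_eq_zero_iff).1 h
  have hu : IsUnit g.1 := by
    rw [Matrix.isUnit_iff_isUnit_det, g.2]; exact isUnit_one
  have hu' : IsUnit g.1ᴴ := by
    rw [Matrix.isUnit_iff_isUnit_det, Matrix.det_conjTranspose, g.2]; simp
  have hA : A.1 = 0 := by
    have h1 := (hu'.mul_left_eq_zero).1 h0
    exact (hu.mul_right_eq_zero).1 h1
  have := A.2.2
  simp [hA] at this

/-- `g ∈ SL(2, ℂ)` acts by the Lorentz transformation `A ↦ g A gᴴ` on rays. -/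
noncomputable instance : SMul SL(2, ℂ) ClosedHyperbolic3 where
  smul g A := ⟨(g.1 * A.1 * g.1ᴴ).trace⁻¹ • (g.1 * A.1 * g.1ᴴ), by
    have hp := A.2.1.mul_mul_conjTranspose_same g.1
    exact hp.smul (inv_nonneg.2 hp.trace_nonneg), by
    rw [Matrix.trace_smul, smul_eq_mul, inv_mul_cancel₀ (trace_conj_ne_zero g A)]⟩

theorem smul_val (g : SL(2, ℂ)) (A : ClosedHyperbolic3) :
    (g • A).1 = (g.1 * A.1 * g.1ᴴ).trace⁻¹ • (g.1 * A.1 * g.1ᴴ) := rfl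

noncomputable instance : MulAction SL(2, ℂ) ClosedHyperbolic3 where
  one_smul A := by
    apply Subtype.ext
    rw [smul_val]
    simp [A.2.2]
  mul_smul g h A := by
    apply Subtype.ext
    have e : ((g * h : SL(2, ℂ)).1 * A.1 * (g * h : SL(2, ℂ)).1ᴴ)
        = g.1 * (h.1 * A.1 * h.1ᴴ) * g.1ᴴ := by
      rw [Matrix.SpecialLinearGroup.coe_mul, Matrix.conjTranspose_mul]
      simp only [Matrix.mul_assoc]
    rw [smul_val, smul_val, smul_val, e]
    have h1 := trace_conj_ne_zero h A
    simp only [Matrix.mul_smul, Matrix.smul_mul, Matrix.trace_smul, smul_eq_mul, smul_smul]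
    congr 1
    field_simp

theorem center_smul (g : SL(2, ℂ)) (hg : g ∈ Subgroup.center SL(2, ℂ)) (A : ClosedHyperbolic3) :
    g • A = A := by
  obtain ⟨r, -, hr'⟩ := Matrix.SpecialLinearGroup.mem_center_iff.1 hg
  have e : g.1 * A.1 * g.1ᴴ = (r * star r) • A.1 := by
    rw [← hr']
    ext i j
    simp [Matrix.scalar_apply, Matrix.mul_apply, Matrix.diagonal_apply]
    fin_cases i <;> fin_cases j <;> simp <;> ring
  have h1 := trace_conj_ne_zero g A
  apply Subtype.ext
  rw [smul_val]
  rw [e] at h1 ⊢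
  rw [Matrix.trace_smul, A.2.2, smul_eq_mul, mul_one] at h1 ⊢
  rw [smul_smul, inv_mul_cancel₀ h1, one_smul]

/-- The action of `PSL(2, ℂ)`, induced from that of `SL(2, ℂ)`. -/
noncomputable def permHom : PSL(2, ℂ) →* Equiv.Perm ClosedHyperbolic3 :=
  QuotientGroup.lift (Subgroup.center SL(2, ℂ)) (MulAction.toPermHom SL(2, ℂ) ClosedHyperbolic3)
    (fun g hg => Equiv.ext fun A => center_smul g hg A)

noncomputable instance : MulAction PSL(2, ℂ) ClosedHyperbolic3 :=
  MulAction.compHom ClosedHyperbolic3 permHom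

end ClosedHyperbolic3

open Classical in
/-- `f` is an ideal homeomorphism of a simplex onto a nondegenerate ideal simplex: the vertices go
to points at infinity spanning a hyperbolic simplex of the full dimension, `f` is a homeomorphism
onto that simplex (their hull), and it takes straight segments to hyperbolic straight segments. -/
structure IsIdealHomeomorphism {ι : Type*} [Fintype ι] (f : stdSimplex ℝ ι → ClosedHyperbolic3) :
    Prop where
  continuous : Continuous f
  injective : Function.Injective f
  vertex_mem : ∀ i, f (stdSimplex.vertex i) ∈ ClosedHyperbolic3.boundary
  nondegenerate : AffineIndependent ℝ fun i => (f (stdSimplex.vertex i)).1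
  range_eq : Set.range (fun t => (f t).1) =
    convexHull ℝ (Set.range fun i => (f (stdSimplex.vertex i)).1)
  image_segment : ∀ x y : stdSimplex ℝ ι,
    (fun t => (f t).1) '' {t | t.1 ∈ segment ℝ x.1 y.1} = segment ℝ (f x).1 (f y).1

/-- An element of `PSL(2, ℂ)` is parabolic if it fixes exactly one point at infinity. -/
def IsParabolicElement (g : PSL(2, ℂ)) : Prop :=
  ∃! z : ClosedHyperbolic3, z ∈ ClosedHyperbolic3.boundary ∧ g • z = z

/-- A subgroup is parabolic if its elements fix a common point at infinity and its nontrivial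
elements are parabolic. -/
def IsParabolicSubgroup (H : Subgroup PSL(2, ℂ)) : Prop :=
  ∃ z ∈ ClosedHyperbolic3.boundary, ∀ h ∈ H, h • z = z ∧ (h ≠ 1 → IsParabolicElement h)

/-! ## Collapsing the components of a subset -/

/-- The equivalence relation collapsing each connected component of `A` to a point. -/
def collapseSetoid {X : Type*} [TopologicalSpace X] (A : Set X) : Setoid X where
  r x y := x = y ∨ y ∈ connectedComponentIn A x
  iseqv := by
    have symm' : ∀ {x y : X}, y ∈ connectedComponentIn A x → x ∈ connectedComponentIn A y := by
      intro x y h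
      have hx : x ∈ A := connectedComponentIn_nonempty_iff.1 ⟨y, h⟩
      rw [← connectedComponentIn_eq h]
      exact mem_connectedComponentIn hx
    refine ⟨fun x => Or.inl rfl, ?_, ?_⟩
    · rintro x y (rfl | h)
      · exact Or.inl rfl
      · exact Or.inr (symm' h)
    · rintro x y z (rfl | h) (rfl | h')
      · exact Or.inl rfl
      · exact Or.inr h'
      · exact Or.inr h
      · exact Or.inr (connectedComponentIn_eq h ▸ h')

/-- The boundary of a (smooth) 3-manifold with boundary. -/
abbrev manifoldBoundary (N : Type*) [TopologicalSpace N] [ChartedSpace (EuclideanHalfSpace 3) N] :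
    Set N :=
  (𝓡∂ 3).boundary N

/-- The compactification of the interior of `N` obtained from `N` by collapsing each boundary
component to a point, with the quotient topology. -/
def EndCompactification (N : Type*) [TopologicalSpace N]
    [ChartedSpace (EuclideanHalfSpace 3) N] : Type _ :=
  Quotient (collapseSetoid (manifoldBoundary N))

namespace EndCompactification

variable {N : Type*} [TopologicalSpace N] [ChartedSpace (EuclideanHalfSpace 3) N]

instance : TopologicalSpace (EndCompactification N) :=
  inferInstanceAs (TopologicalSpace (Quotient (collapseSetoid (manifoldBoundary N))))

/-- The quotient map. -/
def mk (x : N) : EndCompactification N := Quotient.mk (collapseSetoid (manifoldBoundary N)) x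

variable (N) in
/-- The ideal points: the points corresponding to the ends. -/
def idealPoints : Set (EndCompactification N) := mk '' manifoldBoundary N

end EndCompactification

/-- For a covering `q : W → N`, the space obtained from the interior of `W` by adding one ideal
point for each lift of an end, i.e. for each connected component of the preimage of the
boundary of `N`. -/
def CoverCompletion {N W : Type*} [TopologicalSpace N] [ChartedSpace (EuclideanHalfSpace 3) N]
    [TopologicalSpace W] (q : C(W, N)) : Type _ :=
  Quotient (collapseSetoid (q ⁻¹' manifoldBoundary N))

namespace CoverCompletion

variable {N W : Type*} [TopologicalSpace N] [ChartedSpace (EuclideanHalfSpace 3) N]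
  [TopologicalSpace W] (q : C(W, N))

/-- The quotient map. -/
def mk (w : W) : CoverCompletion q :=
  Quotient.mk (collapseSetoid (q ⁻¹' manifoldBoundary N)) w

/-- The topology whose open sets are generated by the components of the preimages of open sets
of the compactification of the base. On the interior this is the topology of `W`; near a lifted
end the neighbourhoods of the ideal point are the components over the neighbourhoods of the
end downstairs. (The lifted end may be noncompact, and the quotient topology is then too fine
for simplices to lift.) -/
instance : TopologicalSpace (CoverCompletion q) :=
  TopologicalSpace.generateFrom
    {S | ∃ U : Set (EndCompactification N), IsOpen U ∧ ∃ w : W,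
      S = mk q '' connectedComponentIn ((fun v => EndCompactification.mk (q v)) ⁻¹' U) w}

/-- The extension of the covering map. -/
def proj : CoverCompletion q → EndCompactification N :=
  Quotient.lift (fun w => EndCompactification.mk (q w)) (by
    rintro a b (rfl | h)
    · rfl
    · apply Quotient.sound
      right
      have ha : a ∈ q ⁻¹' manifoldBoundary N := connectedComponentIn_nonempty_iff.1 ⟨b, h⟩
      have hsub : q '' connectedComponentIn (q ⁻¹' manifoldBoundary N) a ⊆ manifoldBoundary N := by
        rintro _ ⟨c, hc, rfl⟩
        exact connectedComponentIn_subset (q ⁻¹' manifoldBoundary N) a hc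
      exact (isPreconnected_connectedComponentIn.image q
        q.continuous.continuousOn).subset_connectedComponentIn
          ⟨a, mem_connectedComponentIn ha, rfl⟩ hsub ⟨b, h, rfl⟩)

end CoverCompletion

/-! ## Fundamental group, covering transformations, peripheral subgroups -/

/-- The fundamental group with the product "first `α`, then `β`" of loops. (The multiplication of
`FundamentalGroup` composes in the opposite order.) With this convention it acts from the left
on the universal cover. -/
abbrev LoopGroup (X : Type*) [TopologicalSpace X] (x : X) : Type _ := (FundamentalGroup X x)ᵐᵒᵖ

/-- `φ` is the covering transformation by which `γ` acts: it moves the chosen lift `w₀` of the base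
point to the endpoint of the lift of `γ` starting at `w₀`. -/
def IsCoveringTransformation {N W : Type*} [TopologicalSpace N] [TopologicalSpace W] (q : C(W, N))
    (w₀ : W) (γ : LoopGroup N (q w₀)) (φ : W ≃ₜ W) : Prop :=
  ∃ h : ∀ w, q (φ w) = q w, ∃ p : Path w₀ (φ w₀),
    FundamentalGroup.fromPath
      (Path.Homotopic.Quotient.mk ((p.map q.continuous).cast rfl (h w₀).symm)) = γ.unop

/-- The peripheral subgroup of the component `E` of `A` containing `e`, defined by the path `α` from
the base point to `e`: the classes of the loops `α · β · α⁻¹` with `β` a loop in `E`. -/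
noncomputable def peripheralSubgroup {X : Type*} [TopologicalSpace X] {A : Set X} {x e : X}
    (he : e ∈ A) (α : Path x e) : Subgroup (LoopGroup X x) :=
  ((FundamentalGroup.map (⟨Subtype.val, continuous_subtype_val⟩ : C(connectedComponentIn A e, X))
      ⟨e, mem_connectedComponentIn he⟩).range.map
    (FundamentalGroup.fundamentalGroupMulEquivOfPath α).symm.toMonoidHom).op

/-- A representation is boundary-parabolic if it takes every peripheral subgroup to a parabolic
subgroup. -/
def IsBoundaryParabolic {N : Type*} [TopologicalSpace N] [ChartedSpace (EuclideanHalfSpace 3) N]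
    {x : N} (ρ : LoopGroup N x →* PSL(2, ℂ)) : Prop :=
  ∀ (e : N) (he : e ∈ manifoldBoundary N) (α : Path x e),
    IsParabolicSubgroup ((peripheralSubgroup he α).map ρ)

/-- The end through the boundary point `e` is nontrivial with respect to `ρ`: its peripheral
subgroups (which are conjugate to each other) have nontrivial image. -/
def IsNontrivialEnd {N : Type*} [TopologicalSpace N] [ChartedSpace (EuclideanHalfSpace 3) N]
    {x : N} (ρ : LoopGroup N x →* PSL(2, ℂ)) {e : N} (he : e ∈ manifoldBoundary N) : Prop :=
  ∃ α : Path x e, (peripheralSubgroup he α).map ρ ≠ ⊥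

/-! ## Complexes of simplices -/

/-- The open simplex. -/
def openSimplex (ι : Type*) [Fintype ι] : Set (stdSimplex ℝ ι) := {t | ∀ i, 0 < t i}

/-- An identification of the space `X` with a finite complex of dimension at most three obtained by
gluing simplices along faces by simplicial maps, such that open simplices embed. Closed simplices
need not embed. (For compact Hausdorff `X` the gluing topology is automatic.) -/
structure SimplexComplex (X : Type*) [TopologicalSpace X] where
  /-- the cells -/
  Cell : Type
  finite_cell : Finite Cell
  /-- the vertices of the simplex of a cell -/
  Vert : Cell → Type
  fintype_vert : ∀ σ, Fintype (Vert σ)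
  nonempty_vert : ∀ σ, Nonempty (Vert σ)
  card_vert_le : ∀ σ, Fintype.card (Vert σ) ≤ 4
  /-- the characteristic map of a cell -/
  char : ∀ σ, C(stdSimplex ℝ (Vert σ), X)
  injOn_char : ∀ σ, Set.InjOn (char σ) (openSimplex (Vert σ))
  existsUnique_cell : ∀ x, ∃! σ, x ∈ char σ '' openSimplex (Vert σ)
  exists_face : ∀ σ (s : Set (Vert σ)), s.Nonempty → ∃ τ, ∃ f : Vert τ → Vert σ,
    Function.Injective f ∧ Set.range f = s ∧ ∀ t, char τ t = char σ (stdSimplex.map f t)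

attribute [instance] SimplexComplex.fintype_vert SimplexComplex.nonempty_vert

/-- The zero-cells, as points of the space. -/
def SimplexComplex.zeroCells {X : Type*} [TopologicalSpace X] (K : SimplexComplex X) : Set X :=
  {x | ∃ σ, Fintype.card (K.Vert σ) = 1 ∧ ∃ t, K.char σ t = x}

/-! ### Barycentric subdivision -/

open Classical in
/-- The point of the simplex on `V` which is the combination with weights `t` of the barycentres of
the faces `F` in `c`. -/
noncomputable def baryFun {V : Type*} (c : Finset (Finset V)) (t : c → ℝ) (v : V) : ℝ :=
  ∑ F : c, t F * (if v ∈ F.1 then (F.1.card : ℝ)⁻¹ else 0)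

/-- A flag of faces of the simplex on `V` that ends with the whole simplex. -/
def IsFullFlag {V : Type*} [Fintype V] (c : Finset (Finset V)) : Prop :=
  Finset.univ ∈ c ∧ (∀ F ∈ c, F.Nonempty) ∧ IsChain (· ⊆ ·) (c : Set (Finset V))

theorem baryFun_mem {V : Type*} [Fintype V] {c : Finset (Finset V)} (hc : ∀ F ∈ c, F.Nonempty)
    (t : stdSimplex ℝ c) : baryFun c t ∈ stdSimplex ℝ V := by
  classical
  constructor
  · intro v
    unfold baryFun
    refine Finset.sum_nonneg fun F _ => mul_nonneg (t.2.1 F) ?_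
    split_ifs <;> positivity
  · unfold baryFun
    rw [Finset.sum_comm, ← t.2.2]
    refine Finset.sum_congr rfl fun F _ => ?_
    rw [← Finset.mul_sum, Finset.sum_ite_mem, Finset.univ_inter, Finset.sum_const, nsmul_eq_mul,
      mul_inv_cancel₀, mul_one]
    · rfl
    · exact_mod_cast (hc F.1 F.2).card_pos.ne'

/-- The affine map from the simplex on the vertex set `c` to the simplex on `V` which takes the
vertex `F ∈ c` to the barycentre of the face `F`. -/
noncomputable def baryMap {V : Type*} [Fintype V] (c : Finset (Finset V))
    (hc : ∀ F ∈ c, F.Nonempty) : C(stdSimplex ℝ c, stdSimplex ℝ V) where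
  toFun t := ⟨baryFun c t, baryFun_mem hc t⟩
  continuous_toFun := by
    refine Continuous.subtype_mk (continuous_pi fun v => ?_) _
    unfold baryFun
    refine continuous_finsetSum _ fun F _ => Continuous.mul ?_ continuous_const
    exact (continuous_apply F).comp continuous_subtype_val

set_option linter.unusedSectionVars false

section FlagLemmas

variable {V : Type*} [Fintype V]

theorem baryFun_pos {c : Finset (Finset V)} (hc : IsFullFlag c) {t : c → ℝ} (ht : ∀ F, 0 < t F)
    (v : V) : 0 < baryFun c t v := by
  classical
  unfold baryFun
  refine Finset.sum_pos' (fun F _ => mul_nonneg (ht F).le ?_)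
    ⟨⟨Finset.univ, hc.1⟩, Finset.mem_univ _, mul_pos (ht _) ?_⟩
  · split_ifs <;> positivity
  · have : 0 < (Finset.univ : Finset V).card := Finset.card_pos.2 ⟨v, Finset.mem_univ v⟩
    simp only [Finset.mem_univ, if_true]
    positivity

theorem baryMap_mem_openSimplex {c : Finset (Finset V)} (hc : IsFullFlag c) {t : stdSimplex ℝ c}
    (ht : t ∈ openSimplex c) : baryMap c hc.2.1 t ∈ openSimplex V :=
  fun v => baryFun_pos hc ht v

theorem baryFun_lt {c : Finset (Finset V)} (hc : IsFullFlag c) {t : c → ℝ} (ht : ∀ F, 0 < t F)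
    {F : Finset V} (hF : F ∈ c) {v w : V} (hv : v ∈ F) (hw : w ∉ F) :
    baryFun c t w < baryFun c t v := by
  classical
  have key : ∀ G ∈ c, w ∈ G → v ∈ G := by
    intro G hG hwG
    rcases hc.2.2.total hG hF with h | h
    · exact absurd (h hwG) hw
    · exact h hv
  unfold baryFun
  refine Finset.sum_lt_sum (fun G _ => mul_le_mul_of_nonneg_left ?_ (ht G).le)
    ⟨⟨F, hF⟩, Finset.mem_univ _, mul_lt_mul_of_pos_left ?_ (ht _)⟩
  · by_cases h : w ∈ G.1
    · simp [h, key G.1 G.2 h]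
    · simp only [h, if_false]
      split_ifs <;> positivity
  · have : 0 < F.card := Finset.card_pos.2 ⟨v, hv⟩
    simp only [hv, hw, if_true, if_false]
    positivity

theorem baryFun_le_of_forall {c : Finset (Finset V)} {t : c → ℝ} (ht : ∀ F, 0 < t F) {v w : V}
    (h : ∀ G ∈ c, w ∈ G → v ∈ G) : baryFun c t w ≤ baryFun c t v := by
  classical
  unfold baryFun
  refine Finset.sum_le_sum fun G _ => mul_le_mul_of_nonneg_left ?_ (ht G).le
  by_cases hw : w ∈ G.1
  · simp [hw, h G.1 G.2 hw]
  · simp only [hw, if_false]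
    split_ifs <;> positivity

theorem mem_flag_iff {c : Finset (Finset V)} (hc : IsFullFlag c) {t : c → ℝ} (ht : ∀ F, 0 < t F)
    (F : Finset V) :
    F ∈ c ↔ ∃ v, ∀ w, w ∈ F ↔ baryFun c t v ≤ baryFun c t w := by
  classical
  constructor
  · intro hF
    obtain ⟨v, hv, hmin⟩ := F.exists_min_image (baryFun c t) (hc.2.1 F hF)
    refine ⟨v, fun w => ⟨fun hw => hmin w hw, fun hw => ?_⟩⟩
    by_contra hwF
    exact absurd (baryFun_lt hc ht hF hv hwF) (not_lt.2 hw)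
  · rintro ⟨v, hv⟩
    obtain ⟨G, hG, hGmin⟩ := (c.filter (v ∈ ·)).exists_min_image Finset.card
      ⟨Finset.univ, by simp [hc.1]⟩
    rw [Finset.mem_filter] at hG
    have hsub : ∀ H ∈ c, v ∈ H → G ⊆ H := by
      intro H hH hvH
      rcases hc.2.2.total hG.1 hH with h | h
      · exact h
      · exact (Finset.eq_of_subset_of_card_le h (hGmin H (by simp [hH, hvH]))).ge
    have : F = G := by
      ext w
      rw [hv w]
      constructor
      · intro hw
        by_contra hwG
        exact absurd (baryFun_lt hc ht hG.1 hG.2 hwG) (not_lt.2 hw)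
      · intro hw
        exact baryFun_le_of_forall ht fun H hH hvH => hsub H hH hvH hw
    exact this ▸ hG.1

/-- A point determines the flag of an open simplex of the subdivision in which it lies. -/
theorem flag_unique {c d : Finset (Finset V)} (hc : IsFullFlag c) (hd : IsFullFlag d) {s : c → ℝ}
    {t : d → ℝ} (hs : ∀ F, 0 < s F) (ht : ∀ F, 0 < t F) (h : baryFun c s = baryFun d t) :
    c = d := by
  ext F
  rw [mem_flag_iff hc hs, mem_flag_iff hd ht, h]

theorem baryFun_injective {c : Finset (Finset V)} (hne : ∀ F ∈ c, F.Nonempty)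
    (hch : IsChain (· ⊆ ·) (c : Set (Finset V))) {s t : c → ℝ}
    (h : baryFun c s = baryFun c t) : s = t := by
  classical
  by_contra hst
  obtain ⟨F0, hF0⟩ := Function.ne_iff.1 hst
  obtain ⟨F, hF, hmax⟩ := (Finset.univ.filter fun F : c => s F ≠ t F).exists_max_image
    (fun F => F.1.card) ⟨F0, by simp [hF0]⟩
  rw [Finset.mem_filter] at hF
  -- a vertex of `F` in no smaller member of the chain
  obtain ⟨v, hv, hv'⟩ : ∃ v ∈ F.1, ∀ G : c, v ∈ G.1 → F.1 ⊆ G.1 := by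
    by_cases he : (Finset.univ.filter fun G : c => G.1 ⊂ F.1).Nonempty
    · obtain ⟨G, hG, hGm⟩ := Finset.exists_max_image _ (fun G : c => G.1.card) he
      rw [Finset.mem_filter] at hG
      obtain ⟨v, hv, hvG⟩ := Finset.exists_of_ssubset hG.2
      refine ⟨v, hv, fun H hvH => ?_⟩
      rcases hch.total F.2 H.2 with hh | hh
      · exact hh
      · by_contra hcon
        have hHF : H.1 ⊂ F.1 := ⟨hh, hcon⟩
        have hle := hGm H (Finset.mem_filter.2 ⟨Finset.mem_univ _, hHF⟩)
        rcases hch.total H.2 G.2 with h1 | h1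
        · exact hvG (h1 hvH)
        · exact hvG ((Finset.eq_of_subset_of_card_le h1 hle).ge hvH)
    · obtain ⟨v, hv⟩ := hne F.1 F.2
      refine ⟨v, hv, fun H _ => ?_⟩
      rcases hch.total F.2 H.2 with hh | hh
      · exact hh
      · by_contra hcon
        exact he ⟨H, Finset.mem_filter.2 ⟨Finset.mem_univ _, hh, hcon⟩⟩
  have hev := congrFun h v
  unfold baryFun at hev
  rw [← sub_eq_zero, ← Finset.sum_sub_distrib, Finset.sum_eq_single F] at hev
  · have hpos : (0 : ℝ) < (F.1.card : ℝ)⁻¹ := by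
      have := (hne F.1 F.2).card_pos
      positivity
    simp only [hv, if_true, ← sub_mul] at hev
    rcases mul_eq_zero.1 hev with h0 | h0
    · exact hF.2 (sub_eq_zero.1 h0)
    · exact hpos.ne' h0
  · intro G _ hGF
    by_cases hvG : v ∈ G.1
    · have hsub := hv' G hvG
      have hst' : s G = t G := by
        by_contra hcon
        have hle := hmax G (by simp [hcon])
        exact hGF (Subtype.ext (Finset.eq_of_subset_of_card_le hsub hle).symm)
      rw [hst', sub_self]
    · simp [hvG]
  · intro hcon
    exact absurd (Finset.mem_univ F) hcon

/-- A nonnegative function is a positive combination of indicator functions of a chain. -/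
theorem exists_chain_sum [DecidableEq V] (n : ℕ) : ∀ (t : V → ℝ), (∀ v, 0 ≤ t v) →
    (Finset.univ.filter fun v => t v ≠ 0).card ≤ n →
    ∃ (c : Finset (Finset V)) (a : Finset V → ℝ),
      (∀ F ∈ c, F.Nonempty ∧ F ⊆ Finset.univ.filter fun v => t v ≠ 0) ∧
      IsChain (· ⊆ ·) (c : Set (Finset V)) ∧ (∀ F ∈ c, 0 < a F) ∧
      ((Finset.univ.filter fun v => t v ≠ 0).Nonempty →
        (Finset.univ.filter fun v => t v ≠ 0) ∈ c) ∧
      ∀ v, t v = ∑ F ∈ c, if v ∈ F then a F else 0 := by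
  induction n with
  | zero =>
    intro t _ hcard
    have he : (Finset.univ.filter fun v => t v ≠ 0) = ∅ := Finset.card_eq_zero.1 (by omega)
    refine ⟨∅, 0, by simp, by simp, by simp, fun h => absurd he h.ne_empty, fun v => ?_⟩
    by_contra hv
    have : v ∈ Finset.univ.filter fun v => t v ≠ 0 := by simpa using hv
    simp [he] at this
  | succ n ih =>
    intro t ht hcard
    set S := Finset.univ.filter fun v => t v ≠ 0 with hS
    by_cases hne : S.Nonempty
    · obtain ⟨u, hu, hmin⟩ := S.exists_min_image t hne
      have hupos : 0 < t u := lt_of_le_of_ne (ht u) (by simpa [hS, eq_comm] using hu)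
      set t' : V → ℝ := fun v => t v - if v ∈ S then t u else 0 with ht'
      have ht'0 : ∀ v, 0 ≤ t' v := by
        intro v
        by_cases hv : v ∈ S
        · simpa [ht', hv] using hmin v hv
        · simpa [ht', hv] using ht v
      set S' := Finset.univ.filter fun v => t' v ≠ 0 with hS'
      have hsub : S' ⊆ S.erase u := by
        intro v hv
        have hv0 : t' v ≠ 0 := by simpa [hS'] using hv
        have hvS : v ∈ S := by
          by_contra hcon
          have : t v = 0 := by simpa [hS] using hcon
          exact hv0 (by simp [ht', hcon, this])
        refine Finset.mem_erase.2 ⟨?_, hvS⟩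
        rintro rfl
        exact hv0 (by simp [ht', hvS])
      have hcard' : S'.card ≤ n := by
        have h1 := Finset.card_le_card hsub
        rw [Finset.card_erase_of_mem hu] at h1
        omega
      obtain ⟨c, a, h1, h2, h3, -, h5⟩ := ih t' ht'0 hcard'
      have hSc : S ∉ c := fun hcon =>
        absurd (hsub ((h1 S hcon).2 hu)) (Finset.notMem_erase u S)
      have hlt : ∀ F ∈ c, F ⊆ S := fun F hF =>
        ((h1 F hF).2.trans hsub).trans (Finset.erase_subset _ _)
      refine ⟨insert S c, Function.update a S (t u), ?_, ?_, ?_, fun _ => Finset.mem_insert_self _ _,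
        fun v => ?_⟩
      · intro F hF
        rcases Finset.mem_insert.1 hF with rfl | hF
        · exact ⟨hne, subset_rfl⟩
        · exact ⟨(h1 F hF).1, hlt F hF⟩
      · rw [Finset.coe_insert]
        exact h2.insert fun F hF _ => Or.inr (hlt F hF)
      · intro F hF
        rcases Finset.mem_insert.1 hF with rfl | hF
        · simpa using hupos
        · rw [Function.update_of_ne (by rintro rfl; exact hSc hF)]
          exact h3 F hF
      · rw [Finset.sum_insert hSc]
        have e : ∑ F ∈ c, (if v ∈ F then Function.update a S (t u) F else 0)
            = ∑ F ∈ c, if v ∈ F then a F else 0 := by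
          refine Finset.sum_congr rfl fun F hF => ?_
          rw [Function.update_of_ne (by rintro rfl; exact hSc hF)]
        rw [e, ← h5 v]
        simp [ht']
    · refine ⟨∅, 0, by simp, by simp, by simp, fun h => absurd h hne, fun v => ?_⟩
      by_contra hv
      exact hne ⟨v, by simpa [hS] using hv⟩

/-- Every interior point of the simplex lies in an open simplex of the subdivision. -/
theorem exists_flag [Nonempty V] (x : stdSimplex ℝ V) (hx : x ∈ openSimplex V) :
    ∃ (c : Finset (Finset V)) (hc : IsFullFlag c) (s : stdSimplex ℝ c), s ∈ openSimplex c ∧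
      baryMap c hc.2.1 s = x := by
  classical
  have hS : (Finset.univ.filter fun v => x.1 v ≠ 0) = Finset.univ := by
    ext v
    have h0 : x.1 v ≠ 0 := (hx v).ne'
    simpa using h0
  obtain ⟨c, a, h1, h2, h3, h4, h5⟩ := exists_chain_sum _ x.1 x.2.1 le_rfl
  rw [hS] at h4
  have hc : IsFullFlag c := ⟨h4 Finset.univ_nonempty, fun F hF => (h1 F hF).1, h2⟩
  have hpos : ∀ F ∈ c, (0 : ℝ) < F.card := fun F hF => by exact_mod_cast (h1 F hF).1.card_pos
  have hb : ∀ v, baryFun c (fun F => (F.1.card : ℝ) * a F.1) v = x.1 v := by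
    intro v
    unfold baryFun
    rw [h5 v, Finset.univ_eq_attach,
      Finset.sum_attach c fun F => (F.card : ℝ) * a F * if v ∈ F then (F.card : ℝ)⁻¹ else 0]
    refine Finset.sum_congr rfl fun F hF => ?_
    have := (hpos F hF).ne'
    split_ifs
    · field_simp
    · simp
  have hsum : ∑ F : c, (F.1.card : ℝ) * a F.1 = 1 := by
    rw [← x.2.2]
    simp_rw [h5]
    rw [Finset.sum_comm, Finset.univ_eq_attach,
      Finset.sum_attach c fun F => (F.card : ℝ) * a F]
    refine Finset.sum_congr rfl fun F _ => ?_
    rw [Finset.sum_ite_mem, Finset.univ_inter, Finset.sum_const, nsmul_eq_mul]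
  refine ⟨c, hc, ⟨fun F => (F.1.card : ℝ) * a F.1,
    fun F => (mul_pos (hpos F.1 F.2) (h3 F.1 F.2)).le, hsum⟩,
    fun F => mul_pos (hpos F.1 F.2) (h3 F.1 F.2), ?_⟩
  apply Subtype.ext
  funext v
  exact hb v

theorem card_flag_le {c : Finset (Finset V)} (hc : IsFullFlag c) : c.card ≤ Fintype.card V := by
  classical
  have : c.card ≤ (Finset.Icc 1 (Fintype.card V)).card := by
    refine Finset.card_le_card_of_injOn Finset.card (fun F hF => ?_) ?_
    · simp only [Finset.coe_Icc, Set.mem_Icc]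
      exact ⟨(hc.2.1 F hF).card_pos, Finset.card_le_univ F⟩
    · intro F hF G hG h
      rcases hc.2.2.total hF hG with h' | h'
      · exact Finset.eq_of_subset_of_card_le h' h.ge
      · exact (Finset.eq_of_subset_of_card_le h' h.le).symm
  simpa using this

end FlagLemmas

open Classical in
/-- Passing from a face to the whole simplex commutes with the barycentric maps. -/
theorem map_baryMap {U V : Type*} [Fintype U] [Fintype V] (f : U ↪ V) {d : Finset (Finset U)}
    {c : Finset (Finset V)} (hd : ∀ F ∈ d, F.Nonempty) (hc : ∀ F ∈ c, F.Nonempty) (g : d → c)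
    (hg : ∀ G, (g G).1 = G.1.map f) (t : stdSimplex ℝ d) :
    stdSimplex.map f (baryMap d hd t) = baryMap c hc (stdSimplex.map g t) := by
  apply Subtype.ext
  funext v
  change (FunOnFinite.linearMap ℝ ℝ f (baryFun d t)) v =
    baryFun c (FunOnFinite.linearMap ℝ ℝ g t) v
  rw [FunOnFinite.linearMap_apply_apply]
  unfold baryFun
  simp_rw [FunOnFinite.linearMap_apply_apply, Finset.sum_mul]
  rw [Finset.sum_comm]
  have hR : ∀ G : c, (∑ i with g i = G, t i * (if v ∈ G.1 then (G.1.card : ℝ)⁻¹ else 0)) =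
      ∑ i with g i = G, t i * (if v ∈ (g i).1 then ((g i).1.card : ℝ)⁻¹ else 0) := by
    intro G
    refine Finset.sum_congr rfl fun i hi => ?_
    rw [(Finset.mem_filter.1 hi).2]
  simp_rw [hR]
  rw [Finset.sum_fiberwise Finset.univ g
    (fun i => t i * (if v ∈ (g i).1 then ((g i).1.card : ℝ)⁻¹ else 0))]
  refine Finset.sum_congr rfl fun G _ => ?_
  rw [← Finset.mul_sum]
  congr 1
  rw [hg, Finset.card_map]
  by_cases hv : v ∈ G.1.map f
  · obtain ⟨u, hu, rfl⟩ := Finset.mem_map.1 hv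
    rw [if_pos hv, Finset.sum_eq_single u]
    · simp [hu]
    · intro w hw hwu
      exact absurd (f.injective (Finset.mem_filter.1 hw).2) hwu
    · intro h
      simp at h
  · rw [if_neg hv]
    refine Finset.sum_eq_zero fun w hw => ?_
    rw [if_neg]
    intro hwG
    exact hv (Finset.mem_map.2 ⟨w, hwG, (Finset.mem_filter.1 hw).2⟩)

/-- The barycentric subdivision: the simplices are the flags of faces of the simplices of `K`, a
flag being recorded with the simplex of `K` in whose interior it lies. -/
noncomputable def SimplexComplex.barycentricSubdivision {X : Type*} [TopologicalSpace X]
    (K : SimplexComplex X) : SimplexComplex X where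
  Cell := Σ σ : K.Cell, {c : Finset (Finset (K.Vert σ)) // IsFullFlag c}
  finite_cell := by
    have := K.finite_cell
    infer_instance
  Vert p := p.2.1
  fintype_vert p := inferInstance
  nonempty_vert p := ⟨⟨Finset.univ, p.2.2.1⟩⟩
  card_vert_le p := by
    rw [Fintype.card_coe]
    exact (card_flag_le p.2.2).trans (K.card_vert_le p.1)
  char p := (K.char p.1).comp (baryMap p.2.1 p.2.2.2.1)
  injOn_char p := by
    intro s hs t ht h
    have h1 := K.injOn_char p.1 (baryMap_mem_openSimplex p.2.2 hs)
      (baryMap_mem_openSimplex p.2.2 ht) h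
    exact Subtype.ext (baryFun_injective p.2.2.2.1 p.2.2.2.2 (congrArg Subtype.val h1))
  existsUnique_cell x := by
    obtain ⟨σ, ⟨u, hu, hux⟩, huniq⟩ := K.existsUnique_cell x
    obtain ⟨c, hc, s, hs, hsu⟩ := exists_flag u hu
    refine ⟨⟨σ, c, hc⟩, ⟨s, hs, ?_⟩, ?_⟩
    · change K.char σ (baryMap c hc.2.1 s) = x
      rw [hsu, hux]
    · rintro ⟨τ, d, hd⟩ ⟨t, ht, htx⟩
      change K.char τ (baryMap d hd.2.1 t) = x at htx
      obtain rfl : τ = σ := huniq τ ⟨_, baryMap_mem_openSimplex hd ht, htx⟩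
      have h1 : baryMap d hd.2.1 t = baryMap c hc.2.1 s :=
        K.injOn_char τ (baryMap_mem_openSimplex hd ht) (baryMap_mem_openSimplex hc hs)
          (by rw [htx, hsu, hux])
      obtain rfl : d = c := flag_unique hd hc ht hs (congrArg Subtype.val h1)
      rfl
  exists_face := by
    classical
    rintro ⟨σ, c, hc⟩ s hs
    obtain ⟨F, hFs, hFmax⟩ := (Set.toFinite s).toFinset.exists_max_image (fun F : c => F.1.card)
      (by simpa using hs)
    rw [Set.Finite.mem_toFinset] at hFs
    have hsub : ∀ G ∈ s, G.1 ⊆ F.1 := by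
      intro G hG
      rcases hc.2.2.total G.2 F.2 with h | h
      · exact h
      · exact (Finset.eq_of_subset_of_card_le h (hFmax G (by simpa using hG))).ge
    obtain ⟨τ, f, hf, hfr, hfc⟩ := K.exists_face σ (F.1 : Set (K.Vert σ))
      (by exact_mod_cast hc.2.1 F.1 F.2)
    let f' : K.Vert τ ↪ K.Vert σ := ⟨f, hf⟩
    let d : Finset (Finset (K.Vert τ)) :=
      Finset.univ.filter fun G => ∃ h : G.map f' ∈ c, (⟨G.map f', h⟩ : c) ∈ s
    have hdm : ∀ G, G ∈ d ↔ ∃ h : G.map f' ∈ c, (⟨G.map f', h⟩ : c) ∈ s := by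
      intro G; simp [d]
    have hmapF : (Finset.univ : Finset (K.Vert τ)).map f' = F.1 := by
      apply Finset.coe_injective
      rw [Finset.coe_map, Finset.coe_univ, Set.image_univ]
      exact hfr
    have hd : IsFullFlag d := by
      refine ⟨(hdm _).2 ⟨hmapF ▸ F.2, ?_⟩, fun G hG => ?_, ?_⟩
      · have : (⟨Finset.univ.map f', hmapF ▸ F.2⟩ : c) = F := Subtype.ext hmapF
        rw [this]
        exact hFs
      · obtain ⟨h, -⟩ := (hdm G).1 hG
        exact Finset.map_nonempty.1 (hc.2.1 _ h)
      · intro G hG H hH _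
        obtain ⟨h, -⟩ := (hdm G).1 hG
        obtain ⟨h', -⟩ := (hdm H).1 hH
        rcases hc.2.2.total h h' with h1 | h1
        · exact Or.inl (Finset.map_subset_map.1 h1)
        · exact Or.inr (Finset.map_subset_map.1 h1)
    let g : d → c := fun G => ⟨G.1.map f', ((hdm G.1).1 G.2).1⟩
    refine ⟨⟨τ, d, hd⟩, g, ?_, ?_, ?_⟩
    · intro G H h
      exact Subtype.ext (Finset.map_injective f' (congrArg Subtype.val h))
    · ext G
      constructor
      · rintro ⟨H, rfl⟩
        exact ((hdm H.1).1 H.2).2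
      · intro hG
        have hGm : (Finset.univ.filter fun v => f' v ∈ G.1).map f' = G.1 := by
          ext v
          simp only [Finset.mem_map, Finset.mem_filter, Finset.mem_univ, true_and]
          constructor
          · rintro ⟨u, hu, rfl⟩
            exact hu
          · intro hv
            have : v ∈ Finset.univ.map f' := hmapF ▸ hsub G hG hv
            obtain ⟨u, -, rfl⟩ := Finset.mem_map.1 this
            exact ⟨u, hv, rfl⟩
        have hmem : (Finset.univ.filter fun v => f' v ∈ G.1).map f' ∈ c := by
          rw [hGm]
          exact G.2
        have hGc : (⟨_, hmem⟩ : c) = G := Subtype.ext hGm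
        have hGs : (⟨_, hmem⟩ : c) ∈ s := by
          rw [hGc]
          exact hG
        exact ⟨⟨_, (hdm _).2 ⟨hmem, hGs⟩⟩, Subtype.ext hGm⟩
    · intro t
      change K.char τ (baryMap d hd.2.1 t) = K.char σ (baryMap c hc.2.1 (stdSimplex.map g t))
      rw [hfc, ← map_baryMap f' hd.2.1 hc.2.1 g (fun _ => rfl) t]
      rfl

theorem SimplexComplex.zeroCells_subset_barycentricSubdivision {X : Type*} [TopologicalSpace X]
    (K : SimplexComplex X) : K.zeroCells ⊆ K.barycentricSubdivision.zeroCells := by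
  classical
  rintro x ⟨σ, hσ, t, rfl⟩
  have := Fintype.card_le_one_iff_subsingleton.1 hσ.le
  have hc : IsFullFlag ({Finset.univ} : Finset (Finset (K.Vert σ))) :=
    ⟨Finset.mem_singleton_self _, by simp, by simp⟩
  let s : stdSimplex ℝ ({Finset.univ} : Finset (Finset (K.Vert σ))) :=
    stdSimplex.vertex ⟨Finset.univ, Finset.mem_singleton_self _⟩
  refine ⟨⟨σ, _, hc⟩, Fintype.card_coe ({Finset.univ} : Finset (Finset (K.Vert σ))), s, ?_⟩
  change K.char σ _ = _
  congr 1
  exact Subsingleton.elim _ _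

/-- A triangulation of the interior of the compact 3-manifold `N`: an identification of the end
compactification with a complex of simplices, the ideal points being zero-cells. -/
structure TameTriangulation (N : Type*) [TopologicalSpace N]
    [ChartedSpace (EuclideanHalfSpace 3) N] where
  complex : SimplexComplex (EndCompactification N)
  idealPoints_subset : EndCompactification.idealPoints N ⊆ complex.zeroCells

/-- The barycentric subdivision of a triangulation. -/
noncomputable def TameTriangulation.barycentricSubdivision {N : Type*} [TopologicalSpace N]
    [ChartedSpace (EuclideanHalfSpace 3) N] (T : TameTriangulation N) : TameTriangulation N where
  complex := T.complex.barycentricSubdivision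
  idealPoints_subset :=
    T.idealPoints_subset.trans T.complex.zeroCells_subset_barycentricSubdivision

open Classical in
/-- A combinatorial fineness condition: the vertices of each simplex are distinct points, and at
most one of them is ideal. -/
def TameTriangulation.SeparatesVertices {N : Type*} [TopologicalSpace N]
    [ChartedSpace (EuclideanHalfSpace 3) N] (T : TameTriangulation N) : Prop :=
  ∀ σ : T.complex.Cell,
    (Function.Injective fun i => T.complex.char σ (stdSimplex.vertex i)) ∧
    ∀ i j, T.complex.char σ (stdSimplex.vertex i) ∈ EndCompactification.idealPoints N →
      T.complex.char σ (stdSimplex.vertex j) ∈ EndCompactification.idealPoints N → i = j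

/-! ## Developing maps -/

section Developing

variable {N W : Type*} [TopologicalSpace N] [ChartedSpace (EuclideanHalfSpace 3) N]
  [TopologicalSpace W] {q : C(W, N)} {w₀ : W}

/-- A developing map of `ρ` for the triangulation `T`: a `ρ`-equivariant map from the completed
universal cover to closed hyperbolic space which takes zero-cells to points at infinity and whose
composition with the characteristic map of each cell of the lifted triangulation is an ideal
homeomorphism onto a nondegenerate ideal simplex. The characteristic maps of the lifted
triangulation are the continuous lifts of the characteristic maps of `T`. -/
structure IsDevelopingMap (T : TameTriangulation N) (ρ : LoopGroup N (q w₀) →* PSL(2, ℂ))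
    (D : CoverCompletion q → ClosedHyperbolic3) : Prop where
  equivariant : ∀ γ φ, IsCoveringTransformation q w₀ γ φ →
    ∀ w, D (CoverCompletion.mk q (φ w)) = ρ γ • D (CoverCompletion.mk q w)
  zeroCell : ∀ x, CoverCompletion.proj q x ∈ T.complex.zeroCells →
    D x ∈ ClosedHyperbolic3.boundary
  cell : ∀ (σ : T.complex.Cell) (χ : C(stdSimplex ℝ (T.complex.Vert σ), CoverCompletion q)),
    (∀ t, CoverCompletion.proj q (χ t) = T.complex.char σ t) →
      IsIdealHomeomorphism fun t => D (χ t)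

/-- Two developing maps are equivalent if they agree on the ideal points corresponding to lifts of
nontrivial ends. -/
def DevelopingMapsEquivalent (ρ : LoopGroup N (q w₀) →* PSL(2, ℂ))
    (D D' : CoverCompletion q → ClosedHyperbolic3) : Prop :=
  ∀ (w : W) (hw : q w ∈ manifoldBoundary N), IsNontrivialEnd ρ hw →
    D (CoverCompletion.mk q w) = D' (CoverCompletion.mk q w)

end Developing

/-! The real vector space of Hermitian 2 × 2 matrices, with the determinant as Lorentz form, carries
hyperbolic space as rays inside the cone of positive semidefinite forms and the sphere at infinity
as rays of the light cone. Choosing actual light-cone vectors `H i` over the vertices of a simplex,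
and not only their rays, fixes a straight parametrization: send `t` to the ray of `∑ i, t i • H i`.
On a face this restricts to the same construction, and it commutes with Lorentz transformations. So
a ρ-equivariant choice of light-cone vectors at the vertices of the lifted triangulation yields a
ρ-equivariant map (`exists_straight_extension`), and this is a developing map as soon as the vectors
over each cell are linearly independent (`isIdealHomeomorphism_idealSimplex`).

Equivariant choices exist. Off the ideal points the covering transformations act freely, so vectors
may be prescribed on orbit representatives. The stabilizer of an ideal point acts through a
peripheral subgroup, hence by parabolics with a common fixed point; the eigenvalues of a parabolic
have modulus 1, so it fixes the vectors on the fixed ray and not merely the ray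
(`pslConj_eq_self_of_parabolic`).

Independence is a matter of general position. The vector at a non-ideal vertex varies along a
translate of `coneCurve`, which has only finitely many parameters in any subspace of dimension at
most 3; the finitely many vertices are placed one at a time (`exists_linearIndependent_labelling`).
This needs the vertices of each simplex to be distinct downstairs and at most one of them ideal, the
ideal vectors not being free. One barycentric subdivision achieves both
(`separatesVertices_barycentricSubdivision`).

For the extension to be well defined, a lift of a cell must be determined by its value at one
interior point (`lift_unique`). The completed cover is not a covering near the ideal points, so this
rests on separating distinct lifts of an end by open sets (`exists_isOpen_separating`).

Uniqueness: a nontrivial element of the image of a peripheral subgroup comes from a covering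
transformation fixing an ideal point. A developing map must send that point to a fixed point of the
element at infinity, and a parabolic has only one. -/

/-! ## Hermitian forms and light-cone vectors -/

/-- The Lorentz transformations `A ↦ g A gᴴ`, as a representation of `SL(2, ℂ)`. -/
noncomputable def slConj : SL(2, ℂ) →* Module.End ℝ (Matrix (Fin 2) (Fin 2) ℂ) where
  toFun g :=
    { toFun := fun A => g.1 * A * g.1ᴴ
      map_add' := fun A B => by rw [mul_add, add_mul]
      map_smul' := fun r A => by simp }
  map_one' := by ext1 A; simp
  map_mul' g h := by
    ext1 A
    simp [Matrix.conjTranspose_mul, Matrix.mul_assoc]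

theorem slConj_apply (g : SL(2, ℂ)) (A : Matrix (Fin 2) (Fin 2) ℂ) :
    slConj g A = g.1 * A * g.1ᴴ := rfl

/-- The centre consists of ±1 and the sign cancels in `g A gᴴ`. Hence the linear action, without any
normalization of the trace, descends to `PSL(2, ℂ)`, so that it makes sense for an element to fix a
vector and not only a ray. -/
theorem slConj_eq_one_of_mem_center {g : SL(2, ℂ)} (hg : g ∈ Subgroup.center SL(2, ℂ)) :
    slConj g = 1 := by
  obtain ⟨r, hr, hr'⟩ := Matrix.SpecialLinearGroup.mem_center_iff.1 hg
  have hr2 : r ^ 2 = 1 := by simpa using hr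
  have hrr : r * star r = 1 := by
    rcases mul_self_eq_one_iff.1 (sq r ▸ hr2) with h | h <;> simp [h]
  ext1 A
  rw [slConj_apply, ← hr']
  ext i j
  have : r * A i j * (starRingEnd ℂ) r = A i j := by
    rw [mul_right_comm]
    change r * star r * A i j = _
    rw [hrr, one_mul]
  fin_cases i <;> fin_cases j <;>
    simpa [Matrix.scalar_apply, Matrix.mul_apply, Matrix.diagonal_apply] using this

/-- The representation of `PSL(2, ℂ)` by Lorentz transformations. -/
noncomputable def pslConj : PSL(2, ℂ) →* Module.End ℝ (Matrix (Fin 2) (Fin 2) ℂ) :=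
  QuotientGroup.lift (Subgroup.center SL(2, ℂ)) slConj fun _ hg => slConj_eq_one_of_mem_center hg

theorem pslConj_injective (g : PSL(2, ℂ)) : Function.Injective (pslConj g) := by
  intro A B h
  have := congrArg (pslConj g⁻¹) h
  rw [← Module.End.mul_apply, ← Module.End.mul_apply, ← map_mul, inv_mul_cancel, map_one] at this
  exact this

/-- The positive light cone: nonzero singular positive semidefinite forms. -/
def lightCone : Set (Matrix (Fin 2) (Fin 2) ℂ) := {A | A.PosSemidef ∧ A ≠ 0 ∧ A.det = 0}

theorem pslConj_posSemidef (g : PSL(2, ℂ)) {A : Matrix (Fin 2) (Fin 2) ℂ} (hA : A.PosSemidef) :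
    (pslConj g A).PosSemidef := by
  induction g using QuotientGroup.induction_on with
  | H g => exact hA.mul_mul_conjTranspose_same g.1

theorem pslConj_ne_zero (g : PSL(2, ℂ)) {A : Matrix (Fin 2) (Fin 2) ℂ} (hA : A ≠ 0) :
    pslConj g A ≠ 0 := fun h => hA (pslConj_injective g (h.trans (map_zero _).symm))

theorem pslConj_mem_lightCone (g : PSL(2, ℂ)) {A : Matrix (Fin 2) (Fin 2) ℂ}
    (hA : A ∈ lightCone) : pslConj g A ∈ lightCone := by
  refine ⟨pslConj_posSemidef g hA.1, pslConj_ne_zero g hA.2.1, ?_⟩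
  induction g using QuotientGroup.induction_on with
  | H g =>
    change (g.1 * A * g.1ᴴ).det = 0
    rw [Matrix.det_mul, Matrix.det_mul, hA.2.2]
    simp

/-- The real trace. -/
noncomputable def reTrace : Matrix (Fin 2) (Fin 2) ℂ →ₗ[ℝ] ℝ :=
  Complex.reLm ∘ₗ (Matrix.traceLinearMap (Fin 2) ℝ ℂ)

theorem reTrace_apply (A : Matrix (Fin 2) (Fin 2) ℂ) : reTrace A = A.trace.re := rfl

theorem ofReal_reTrace {A : Matrix (Fin 2) (Fin 2) ℂ} (hA : A.PosSemidef) :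
    ((reTrace A : ℝ) : ℂ) = A.trace :=
  ((Complex.le_def.1 hA.trace_nonneg).elim fun _ h => Complex.ext rfl h)

theorem reTrace_pos {A : Matrix (Fin 2) (Fin 2) ℂ} (hA : A.PosSemidef) (h0 : A ≠ 0) :
    0 < reTrace A := by
  refine lt_of_le_of_ne (Complex.le_def.1 hA.trace_nonneg).1 fun h => h0 ?_
  rw [← hA.trace_eq_zero_iff, ← ofReal_reTrace hA, ← h, Complex.ofReal_zero]

theorem continuous_reTrace : Continuous reTrace :=
  Complex.continuous_re.comp (Continuous.matrix_trace continuous_id)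

theorem posSemidef_real_smul {A : Matrix (Fin 2) (Fin 2) ℂ} (hA : A.PosSemidef) {r : ℝ}
    (hr : 0 ≤ r) : (r • A).PosSemidef := by
  have : r • A = (r : ℂ) • A := by ext; simp
  rw [this]
  exact hA.smul (by exact_mod_cast hr)

open Classical in
/-- The point of closed hyperbolic space on the ray of a form (a fixed point at infinity if the
form is not a nonzero positive semidefinite one). -/
noncomputable def rayPoint (A : Matrix (Fin 2) (Fin 2) ℂ) : ClosedHyperbolic3 :=
  if h : A.PosSemidef ∧ A ≠ 0 then
    ⟨(reTrace A)⁻¹ • A, posSemidef_real_smul h.1 (inv_nonneg.2 (reTrace_pos h.1 h.2).le), by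
      rw [Matrix.trace_smul, ← ofReal_reTrace h.1]
      have := (reTrace_pos h.1 h.2).ne'
      rw [Complex.real_smul, ← Complex.ofReal_mul, inv_mul_cancel₀ this, Complex.ofReal_one]⟩
  else ⟨!![1, 0; 0, 0], by
    have : (!![1, 0; 0, 0] : Matrix (Fin 2) (Fin 2) ℂ) = Matrix.diagonal ![1, 0] := by
      ext i j; fin_cases i <;> fin_cases j <;> simp
    rw [this]
    exact Matrix.PosSemidef.diagonal (by intro i; fin_cases i <;> simp), by simp⟩

theorem rayPoint_val {A : Matrix (Fin 2) (Fin 2) ℂ} (hA : A.PosSemidef) (h0 : A ≠ 0) :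
    (rayPoint A).1 = (reTrace A)⁻¹ • A := by
  exact congrArg Subtype.val (dif_pos ⟨hA, h0⟩)

theorem rayPoint_mem_boundary {A : Matrix (Fin 2) (Fin 2) ℂ} (hA : A ∈ lightCone) :
    rayPoint A ∈ ClosedHyperbolic3.boundary := by
  change (rayPoint A).1.det = 0
  rw [rayPoint_val hA.1 hA.2.1, Matrix.det_smul_of_tower, hA.2.2, smul_zero]

theorem ClosedHyperbolic3.ne_zero (x : ClosedHyperbolic3) : x.1 ≠ 0 := by
  intro h
  have := x.2.2
  rw [h] at this
  simp at this

theorem ClosedHyperbolic3.reTrace_eq_one (x : ClosedHyperbolic3) : reTrace x.1 = 1 := by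
  rw [reTrace_apply, x.2.2, Complex.one_re]

theorem rayPoint_eq_of_smul (x : ClosedHyperbolic3) {A : Matrix (Fin 2) (Fin 2) ℂ} {r : ℝ}
    (hr : 0 < r) (h : A = r • x.1) : rayPoint A = x := by
  have h0 : A ≠ 0 := by rw [h]; exact smul_ne_zero hr.ne' x.ne_zero
  apply Subtype.ext
  rw [rayPoint_val (h ▸ posSemidef_real_smul x.2.1 hr.le) h0, h, map_smul, x.reTrace_eq_one,
    smul_smul, smul_eq_mul, mul_one, inv_mul_cancel₀ hr.ne', one_smul]

theorem smul_val_pslConj (g : PSL(2, ℂ)) (x : ClosedHyperbolic3) :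
    (g • x).1 = (reTrace (pslConj g x.1))⁻¹ • pslConj g x.1 := by
  have hp : (pslConj g x.1).PosSemidef := pslConj_posSemidef g x.2.1
  rw [← Complex.coe_smul, Complex.ofReal_inv, ofReal_reTrace hp]
  induction g using QuotientGroup.induction_on with
  | H g => exact ClosedHyperbolic3.smul_val g x

/-- Through this an equivariant choice of vectors becomes an equivariant choice of points. -/
theorem rayPoint_pslConj (g : PSL(2, ℂ)) {A : Matrix (Fin 2) (Fin 2) ℂ} (hA : A.PosSemidef)
    (h0 : A ≠ 0) : rayPoint (pslConj g A) = g • rayPoint A := by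
  have hp : ∀ x : ClosedHyperbolic3, 0 < reTrace (pslConj g x.1) := fun x =>
    reTrace_pos (pslConj_posSemidef g x.2.1) (pslConj_ne_zero g x.ne_zero)
  refine rayPoint_eq_of_smul _ (r := reTrace A * reTrace (pslConj g (rayPoint A).1))
    (mul_pos (reTrace_pos hA h0) (hp _)) ?_
  have := (hp (rayPoint A)).ne'
  rw [smul_val_pslConj, smul_smul, mul_assoc, mul_inv_cancel₀ this, mul_one,
    rayPoint_val hA h0, map_smul, smul_smul, mul_inv_cancel₀ (reTrace_pos hA h0).ne', one_smul]

theorem smul_eq_of_pslConj_eq_smul {g : PSL(2, ℂ)} {x : ClosedHyperbolic3} {r : ℝ} (hr : 0 < r)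
    (h : pslConj g x.1 = r • x.1) : g • x = x := by
  apply Subtype.ext
  rw [smul_val_pslConj, h, map_smul, x.reTrace_eq_one, smul_smul, smul_eq_mul, mul_one,
    inv_mul_cancel₀ hr.ne', one_smul]

/-! ## Parabolic subgroups fix light-cone vectors -/

theorem vecMulVec_self_star_mem_lightCone {u : Fin 2 → ℂ} (hu : u ≠ 0) :
    Matrix.vecMulVec u (star u) ∈ lightCone := by
  refine ⟨Matrix.posSemidef_vecMulVec_self_star u, fun h => hu ?_, ?_⟩
  · funext i
    have := congrFun (congrFun h i) i
    simpa [Matrix.vecMulVec_apply] using this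
  · rw [Matrix.det_fin_two]
    simp only [Matrix.vecMulVec_apply]
    ring

/-- Since `g (u uᴴ) gᴴ = (g u)(g u)ᴴ`, eigenvectors in `ℂ²` give fixed points at infinity, and the
light-cone vector is scaled by the squared modulus of the eigenvalue. -/
theorem slConj_vecMulVec {g : SL(2, ℂ)} {u : Fin 2 → ℂ} {l : ℂ} (h : g.1 *ᵥ u = l • u) :
    slConj g (Matrix.vecMulVec u (star u)) = Complex.normSq l • Matrix.vecMulVec u (star u) := by
  rw [slConj_apply, Matrix.mul_vecMulVec, Matrix.vecMulVec_mul, ← Matrix.star_mulVec, h]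
  ext i j
  simp only [Matrix.vecMulVec_apply, Pi.smul_apply, Pi.star_apply, smul_eq_mul, star_mul',
    Matrix.smul_apply, Complex.real_smul, Complex.normSq_eq_conj_mul_self]
  simp only [RCLike.star_def]
  ring

theorem exists_eigenvector_of_det {g : SL(2, ℂ)} {l : ℂ} (h : (g.1 - Matrix.scalar (Fin 2) l).det = 0) :
    ∃ u : Fin 2 → ℂ, u ≠ 0 ∧ g.1 *ᵥ u = l • u := by
  obtain ⟨u, hu, hgu⟩ := Matrix.exists_mulVec_eq_zero_iff.2 h
  refine ⟨u, hu, ?_⟩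
  rw [Matrix.sub_mulVec, sub_eq_zero] at hgu
  rw [hgu]
  ext i
  simp [Matrix.scalar_apply, Matrix.mulVec_diagonal]

theorem det_sub_scalar (g : SL(2, ℂ)) (l : ℂ) :
    (g.1 - Matrix.scalar (Fin 2) l).det = l ^ 2 - (g.1 0 0 + g.1 1 1) * l + 1 := by
  have h := g.2
  rw [Matrix.det_fin_two] at h ⊢
  simp [Matrix.scalar_apply]
  linear_combination h

/-- A parabolic element preserves the light-cone vectors on the ray which it fixes. -/
theorem pslConj_eq_self_of_parabolic {g : PSL(2, ℂ)} (hg : IsParabolicElement g)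
    {z : ClosedHyperbolic3} (hz : z ∈ ClosedHyperbolic3.boundary) (hgz : g • z = z) :
    pslConj g z.1 = z.1 := by
  obtain ⟨g, rfl⟩ := QuotientGroup.mk_surjective g
  obtain ⟨z', -, huniq⟩ := hg
  -- every eigenvalue has the same modulus, as its eigenvectors give fixed points
  have key : ∀ l : ℂ, l ≠ 0 → (g.1 - Matrix.scalar (Fin 2) l).det = 0 →
      pslConj (QuotientGroup.mk g) z.1 = Complex.normSq l • z.1 := by
    intro l hl hdet
    obtain ⟨u, hu, hgu⟩ := exists_eigenvector_of_det hdet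
    have hU := vecMulVec_self_star_mem_lightCone hu
    set U := Matrix.vecMulVec u (star u)
    have h1 : pslConj (QuotientGroup.mk g) U = Complex.normSq l • U := slConj_vecMulVec hgu
    have hval := rayPoint_val hU.1 hU.2.1
    have h2 : pslConj (QuotientGroup.mk g) (rayPoint U).1 = Complex.normSq l • (rayPoint U).1 := by
      rw [hval, map_smul, h1, smul_comm]
    have h3 : rayPoint U = z := (huniq _ ⟨rayPoint_mem_boundary hU,
      smul_eq_of_pslConj_eq_smul (Complex.normSq_pos.2 hl) h2⟩).trans (huniq z ⟨hz, hgz⟩).symm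
    rw [← h3, h2]
  -- Determinant 1 makes the eigenvalues come in pairs `l`, `l⁻¹`. By `key` both scale the same
  -- vector `z`, so `|l|² = |l|⁻²` and the modulus is 1.
  obtain ⟨l, hl⟩ : ∃ l : ℂ, l ^ 2 - (g.1 0 0 + g.1 1 1) * l + 1 = 0 := by
    obtain ⟨s, hs⟩ := IsAlgClosed.exists_eq_mul_self ((g.1 0 0 + g.1 1 1) ^ 2 - 4)
    exact ⟨((g.1 0 0 + g.1 1 1) + s) / 2, by linear_combination -hs / 4⟩
  have hl0 : l ≠ 0 := by
    rintro rfl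
    simp at hl
  have hl' : l⁻¹ ^ 2 - (g.1 0 0 + g.1 1 1) * l⁻¹ + 1 = 0 := by
    field_simp
    linear_combination hl
  have e1 := key l hl0 (by rw [det_sub_scalar, hl])
  have e2 := key l⁻¹ (inv_ne_zero hl0) (by rw [det_sub_scalar, hl'])
  have e3 := congrArg reTrace (e1.symm.trans e2)
  rw [map_smul, map_smul, z.reTrace_eq_one, smul_eq_mul, smul_eq_mul, mul_one, mul_one,
    map_inv₀] at e3
  have hpos := Complex.normSq_pos.2 hl0
  have e4 : Complex.normSq l = 1 := by
    have := mul_inv_cancel₀ hpos.ne'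
    rw [← e3] at this
    nlinarith
  rw [e1, e4, one_smul]

/-- A parabolic subgroup preserves a light-cone vector. -/
theorem IsParabolicSubgroup.exists_lightCone {H : Subgroup PSL(2, ℂ)}
    (hH : IsParabolicSubgroup H) : ∃ A ∈ lightCone, ∀ h ∈ H, pslConj h A = A := by
  obtain ⟨z, hz, hzH⟩ := hH
  refine ⟨z.1, ⟨z.2.1, z.ne_zero, hz⟩, fun h hh => ?_⟩
  by_cases h1 : h = 1
  · rw [h1, map_one]; rfl
  · exact pslConj_eq_self_of_parabolic ((hzH h hh).2 h1) hz (hzH h hh).1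

theorem boundary_nonempty : ClosedHyperbolic3.boundary.Nonempty :=
  ⟨_, rayPoint_mem_boundary (vecMulVec_self_star_mem_lightCone
    (u := fun _ => 1) (fun h => one_ne_zero (congrFun h 0)))⟩

/-! ## Straight ideal simplices -/

section IdealSimplex

variable {ι : Type*} [Fintype ι]

theorem reTrace_sum (H : ι → Matrix (Fin 2) (Fin 2) ℂ) (t : ι → ℝ) :
    reTrace (∑ i, t i • H i) = ∑ i, t i * reTrace (H i) := by
  simp [map_sum, map_smul]

theorem sum_smul_posSemidef {H : ι → Matrix (Fin 2) (Fin 2) ℂ} (hH : ∀ i, H i ∈ lightCone)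
    {t : ι → ℝ} (ht : ∀ i, 0 ≤ t i) : (∑ i, t i • H i).PosSemidef :=
  Matrix.posSemidef_sum _ fun i _ => posSemidef_real_smul (hH i).1 (ht i)

theorem reTrace_sum_pos {H : ι → Matrix (Fin 2) (Fin 2) ℂ} (hH : ∀ i, H i ∈ lightCone)
    (t : stdSimplex ℝ ι) : 0 < reTrace (∑ i, t i • H i) := by
  rw [reTrace_sum]
  have hn : ∀ i ∈ Finset.univ, 0 ≤ t i * reTrace (H i) := fun i _ =>
    mul_nonneg (t.2.1 i) (reTrace_pos (hH i).1 (hH i).2.1).le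
  refine lt_of_le_of_ne (Finset.sum_nonneg hn) fun h => ?_
  have h0 := (Finset.sum_eq_zero_iff_of_nonneg hn).1 h.symm
  have h1 : ∑ i, t i = 1 := t.2.2
  rw [Finset.sum_eq_zero fun i hi => (mul_eq_zero.1 (h0 i hi)).resolve_right
    (reTrace_pos (hH i).1 (hH i).2.1).ne'] at h1
  exact zero_ne_one h1

theorem sum_smul_ne_zero {H : ι → Matrix (Fin 2) (Fin 2) ℂ} (hH : ∀ i, H i ∈ lightCone)
    (t : stdSimplex ℝ ι) : ∑ i, t i • H i ≠ 0 := fun h => by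
  have := reTrace_sum_pos hH t
  rw [h, map_zero] at this
  exact lt_irrefl _ this

/-- The straight ideal simplex with given light-cone vectors over its vertices. -/
noncomputable def idealSimplex (H : ι → Matrix (Fin 2) (Fin 2) ℂ) (t : stdSimplex ℝ ι) :
    ClosedHyperbolic3 := rayPoint (∑ i, t i • H i)

theorem idealSimplex_val {H : ι → Matrix (Fin 2) (Fin 2) ℂ} (hH : ∀ i, H i ∈ lightCone)
    (t : stdSimplex ℝ ι) :
    (idealSimplex H t).1 = (reTrace (∑ i, t i • H i))⁻¹ • ∑ i, t i • H i :=
  rayPoint_val (sum_smul_posSemidef hH t.2.1) (sum_smul_ne_zero hH t)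

theorem continuous_idealSimplex {H : ι → Matrix (Fin 2) (Fin 2) ℂ} (hH : ∀ i, H i ∈ lightCone) :
    Continuous (idealSimplex H) := by
  have hS : Continuous fun t : stdSimplex ℝ ι => ∑ i, t i • H i :=
    continuous_finsetSum _ fun i _ => Continuous.smul
      ((continuous_apply i).comp continuous_subtype_val) continuous_const
  refine continuous_induced_rng.2 ?_
  have : (Subtype.val ∘ idealSimplex H) =
      fun t => (reTrace (∑ i, t i • H i))⁻¹ • ∑ i, t i • H i := funext (idealSimplex_val hH)
  refine (continuous_congr fun t => congrFun this t).2 ?_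
  exact ((continuous_reTrace.comp hS).inv₀ fun t => (reTrace_sum_pos hH t).ne').smul hS

theorem idealSimplex_vertex [DecidableEq ι] {H : ι → Matrix (Fin 2) (Fin 2) ℂ} (i : ι) :
    idealSimplex H (stdSimplex.vertex i) = rayPoint (H i) := by
  rw [idealSimplex, Finset.sum_eq_single i]
  · simp [stdSimplex.vertex_coe]
  · intro j _ hj
    simp [stdSimplex.vertex_coe, hj]
  · simp

/-- Independence recovers the coefficients `t i / r` from the image point, where `r` is the trace of
the sum. They add up to `1 / r`, so `r` and then `t` are recovered as well. -/
theorem injective_idealSimplex {H : ι → Matrix (Fin 2) (Fin 2) ℂ} (hH : ∀ i, H i ∈ lightCone)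
    (hli : LinearIndependent ℝ H) : Function.Injective (idealSimplex H) := by
  intro s t hst
  have h := congrArg Subtype.val hst
  rw [idealSimplex_val hH, idealSimplex_val hH, Finset.smul_sum, Finset.smul_sum] at h
  simp only [smul_smul] at h
  rw [← sub_eq_zero, ← Finset.sum_sub_distrib] at h
  simp only [← sub_smul] at h
  have h2 := fun i => sub_eq_zero.1 (Fintype.linearIndependent_iff.1 hli _ h i)
  have hs := reTrace_sum_pos hH s
  have ht := reTrace_sum_pos hH t
  have h3 : (reTrace (∑ i, s i • H i))⁻¹ = (reTrace (∑ i, t i • H i))⁻¹ := by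
    have h4 := Finset.sum_congr rfl fun i (_ : i ∈ Finset.univ) => h2 i
    rw [← Finset.mul_sum, ← Finset.mul_sum, stdSimplex.sum_eq_one, stdSimplex.sum_eq_one, mul_one,
      mul_one] at h4
    exact h4
  apply stdSimplex.ext
  funext i
  have h5 := h2 i
  rw [h3] at h5
  exact mul_left_cancel₀ (inv_ne_zero ht.ne') h5

/-- Before normalization the map is linear in `t`; dividing by the trace is a central projection,
which preserves segments and only changes the weights of the endpoints. -/
theorem image_segment_idealSimplex {H : ι → Matrix (Fin 2) (Fin 2) ℂ} (hH : ∀ i, H i ∈ lightCone)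
    (x y : stdSimplex ℝ ι) :
    (fun t => (idealSimplex H t).1) '' {t | t.1 ∈ segment ℝ x.1 y.1} =
      segment ℝ (idealSimplex H x).1 (idealSimplex H y).1 := by
  have hx := reTrace_sum_pos hH x
  have hy := reTrace_sum_pos hH y
  -- the point of the hyperbolic segment with weights proportional to `a rx` and `b ry`
  have key : ∀ (t : stdSimplex ℝ ι) (a b : ℝ), t.1 = a • x.1 + b • y.1 →
      (idealSimplex H t).1 =
        (a * reTrace (∑ i, x i • H i) * (reTrace (∑ i, t i • H i))⁻¹) • (idealSimplex H x).1 +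
        (b * reTrace (∑ i, y i • H i) * (reTrace (∑ i, t i • H i))⁻¹) • (idealSimplex H y).1 ∧
      reTrace (∑ i, t i • H i) =
        a * reTrace (∑ i, x i • H i) + b * reTrace (∑ i, y i • H i) := by
    intro t a b hab
    have hS : ∑ i, t i • H i = a • ∑ i, x i • H i + b • ∑ i, y i • H i := by
      rw [Finset.smul_sum, Finset.smul_sum, ← Finset.sum_add_distrib]
      refine Finset.sum_congr rfl fun i _ => ?_
      have : t i = a * x i + b * y i := congrFun hab i
      rw [this, add_smul, mul_smul, mul_smul]
    refine ⟨?_, by rw [hS, map_add, map_smul, map_smul, smul_eq_mul, smul_eq_mul]⟩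
    rw [idealSimplex_val hH, idealSimplex_val hH, idealSimplex_val hH, smul_smul, smul_smul]
    generalize reTrace (∑ i, t i • H i) = r
    rw [hS, smul_add, smul_smul, smul_smul]
    congr 2
    · field_simp
    · field_simp
  apply Set.Subset.antisymm
  · rintro _ ⟨t, ⟨a, b, ha, hb, hab, ht⟩, rfl⟩
    obtain ⟨h1, h2⟩ := key t a b ht.symm
    have ht' := reTrace_sum_pos hH t
    refine ⟨_, _, ?_, ?_, ?_, h1.symm⟩
    · positivity
    · positivity
    · rw [← add_mul, ← h2, mul_inv_cancel₀ ht'.ne']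
  · rintro _ ⟨a, b, ha, hb, hab, rfl⟩
    set rx := reTrace (∑ i, x i • H i)
    set ry := reTrace (∑ i, y i • H i)
    -- To hit the point with weights `a`, `b`, the traces `rx`, `ry` of the endpoints must be
    -- divided out; the sum `d` of the resulting weights then restores total weight 1.
    have hpos : 0 < a / rx + b / ry := by
      rcases ha.lt_or_eq with h | h
      · positivity
      · have : b = 1 := by linarith
        rw [← h, this]
        positivity
    set d := a / rx + b / ry
    have hmem : (a / rx / d) • x.1 + (b / ry / d) • y.1 ∈ segment ℝ x.1 y.1 :=
      ⟨_, _, by positivity, by positivity, by rw [← add_div, div_self hpos.ne'], rfl⟩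
    let t : stdSimplex ℝ ι := ⟨_, (convex_stdSimplex ℝ ι).segment_subset x.2 y.2 hmem⟩
    refine ⟨t, hmem, ?_⟩
    obtain ⟨h1, h2⟩ := key t _ _ rfl
    change (idealSimplex H t).1 = _
    have h3 : a / rx / d * rx + b / ry / d * ry = d⁻¹ := by
      field_simp
      exact hab
    change reTrace (∑ i, t i • H i) = a / rx / d * rx + b / ry / d * ry at h2
    rw [h1, h2, h3, inv_inv]
    congr 2
    · field_simp
    · field_simp

theorem idealSimplex_vertex_val [DecidableEq ι] {H : ι → Matrix (Fin 2) (Fin 2) ℂ}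
    (hH : ∀ i, H i ∈ lightCone) (i : ι) :
    (idealSimplex H (stdSimplex.vertex i)).1 = (reTrace (H i))⁻¹ • H i := by
  rw [idealSimplex_vertex, rayPoint_val (hH i).1 (hH i).2.1]

/-- One inclusion reweights the coefficients by the traces of the `H i`. For the other, the image
contains the vertices and is convex, because segments between its points are images of segments. -/
theorem range_idealSimplex [DecidableEq ι] {H : ι → Matrix (Fin 2) (Fin 2) ℂ}
    (hH : ∀ i, H i ∈ lightCone) :
    Set.range (fun t => (idealSimplex H t).1) =
      convexHull ℝ (Set.range fun i => (idealSimplex H (stdSimplex.vertex i)).1) := by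
  apply Set.Subset.antisymm
  · rintro _ ⟨t, rfl⟩
    have hi : ∀ i, 0 < reTrace (H i) := fun i => reTrace_pos (hH i).1 (hH i).2.1
    have ht := reTrace_sum_pos hH t
    refine mem_convexHull_of_exists_fintype
      (fun i => t i * reTrace (H i) * (reTrace (∑ i, t i • H i))⁻¹) _ (fun i => ?_) ?_
      (fun i => Set.mem_range_self i) ?_
    · have := hi i
      have := t.2.1 i
      exact mul_nonneg (mul_nonneg this (hi i).le) (inv_nonneg.2 ht.le)
    · rw [← Finset.sum_mul, ← reTrace_sum, mul_inv_cancel₀ ht.ne']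
    · change _ = (idealSimplex H t).1
      rw [idealSimplex_val hH, Finset.smul_sum]
      refine Finset.sum_congr rfl fun i _ => ?_
      rw [idealSimplex_vertex_val hH, smul_smul, smul_smul]
      congr 1
      have := (hi i).ne'
      field_simp
  · refine convexHull_min ?_ ?_
    · rintro _ ⟨i, rfl⟩
      exact ⟨_, rfl⟩
    · rw [convex_iff_segment_subset]
      rintro _ ⟨x, rfl⟩ _ ⟨y, rfl⟩
      rw [← image_segment_idealSimplex hH]
      exact Set.image_subset_range _ _

theorem isIdealHomeomorphism_idealSimplex {H : ι → Matrix (Fin 2) (Fin 2) ℂ}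
    (hH : ∀ i, H i ∈ lightCone) (hli : LinearIndependent ℝ H) :
    IsIdealHomeomorphism (idealSimplex H) := by
  classical
  refine ⟨continuous_idealSimplex hH, injective_idealSimplex hH hli, fun i => ?_, ?_, ?_,
    image_segment_idealSimplex hH⟩
  · rw [idealSimplex_vertex]
    exact rayPoint_mem_boundary (hH i)
  · simp only [idealSimplex_vertex_val hH]
    -- Scaling the vectors to trace 1 keeps them linearly independent, which is more than affine
    -- independence.
    exact (hli.units_smul fun i => Units.mk0 (reTrace (H i))⁻¹
      (inv_ne_zero (reTrace_pos (hH i).1 (hH i).2.1).ne')).affineIndependent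
  · exact range_idealSimplex hH

end IdealSimplex

/-! ## General position on the light cone -/

/-- A curve of light-cone vectors which meets every proper subspace of the Hermitian forms in a
finite set. -/
noncomputable def coneCurve (t : ℝ) : Matrix (Fin 2) (Fin 2) ℂ :=
  Matrix.vecMulVec ![1, (t + t ^ 2 * Complex.I : ℂ)] (star ![1, (t + t ^ 2 * Complex.I : ℂ)])

theorem coneCurve_mem_lightCone (t : ℝ) : coneCurve t ∈ lightCone :=
  vecMulVec_self_star_mem_lightCone fun h => one_ne_zero (congrFun h 0)

/-- The coefficients of the curve `coneCurve`. -/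
noncomputable def coneCurveCoeff : Fin 4 → Matrix (Fin 2) (Fin 2) ℂ :=
  ![!![1, 0; 0, 0], !![0, 1; 1, 0], !![0, -Complex.I; Complex.I, 1], !![0, 0; 0, 1]]

/-- With `z = t + i t²` the entries are `1`, `z̄`, `z` and `|z|² = t² + t⁴`. The point of this
choice of `z` is that the four coefficients of the resulting polynomial are linearly independent. -/
theorem coneCurve_eq (t : ℝ) : coneCurve t = coneCurveCoeff 0 + t • coneCurveCoeff 1 +
    t ^ 2 • coneCurveCoeff 2 + t ^ 4 • coneCurveCoeff 3 := by
  ext i j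
  fin_cases i <;> fin_cases j <;>
    simp [coneCurve, coneCurveCoeff, Matrix.vecMulVec_apply]
  all_goals (ring_nf; simp)

theorem linearIndependent_coneCurveCoeff : LinearIndependent ℝ coneCurveCoeff := by
  rw [Fintype.linearIndependent_iff]
  intro g hg
  rw [Fin.sum_univ_four] at hg
  have h00 := congrFun (congrFun hg 0) 0
  have h01 := congrFun (congrFun hg 0) 1
  have h11 := congrFun (congrFun hg 1) 1
  simp [coneCurveCoeff] at h00 h01 h11
  have h1 : g 1 = 0 := by simpa using congrArg Complex.re h01
  have h2 : g 2 = 0 := by simpa using congrArg Complex.im h01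
  have h3 : g 3 = 0 := by simpa [h2] using h11
  intro i
  fin_cases i <;> assumption

/-- Four independent coefficients cannot all lie in `V`. A functional vanishing on `V` but not on
some coefficient turns the curve into a nonzero real polynomial, of which every parameter in
question is a root. -/
theorem finite_setOf_coneCurve_mem (V : Submodule ℝ (Matrix (Fin 2) (Fin 2) ℂ))
    (hV : Module.finrank ℝ V ≤ 3) : {t | coneCurve t ∈ V}.Finite := by
  obtain ⟨k, hk⟩ : ∃ k, coneCurveCoeff k ∉ V := by
    by_contra! h
    have h1 : Submodule.span ℝ (Set.range coneCurveCoeff) ≤ V :=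
      Submodule.span_le.2 (Set.range_subset_iff.2 h)
    have h2 := Submodule.finrank_mono h1
    rw [finrank_span_eq_card linearIndependent_coneCurveCoeff, Fintype.card_fin] at h2
    omega
  obtain ⟨f, hfk, hfV⟩ := Submodule.exists_le_ker_of_notMem hk
  let p : Polynomial ℝ := Polynomial.C (f (coneCurveCoeff 0)) +
    Polynomial.C (f (coneCurveCoeff 1)) * Polynomial.X +
    Polynomial.C (f (coneCurveCoeff 2)) * Polynomial.X ^ 2 +
    Polynomial.C (f (coneCurveCoeff 3)) * Polynomial.X ^ 4
  have hp : p ≠ 0 := by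
    intro h
    have hc : ∀ n, p.coeff n = 0 := fun n => by rw [h, Polynomial.coeff_zero]
    have c0 := hc 0
    have c1 := hc 1
    have c2 := hc 2
    have c4 := hc 4
    simp [p, Polynomial.coeff_X, Polynomial.coeff_C, Polynomial.coeff_X_pow] at c0 c1 c2 c4
    apply hfk
    fin_cases k <;> assumption
  refine (Polynomial.finite_setOfPred_isRoot hp).subset fun t ht => ?_
  have h0 : f (coneCurve t) = 0 := hfV ht
  rw [coneCurve_eq] at h0
  simp only [map_add, map_smul, smul_eq_mul] at h0
  simp only [Set.mem_ofPred_eq, Polynomial.IsRoot.def, p, Polynomial.eval_add, Polynomial.eval_mul,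
    Polynomial.eval_C, Polynomial.eval_X, Polynomial.eval_pow]
  linarith

open Classical in
/-- Points in general position: finitely many labelled simplices with at most four distinct
vertices each, whose vertices with labels outside `I` are moved along translates of the curve
`coneCurve`, at most one vertex being fixed. -/
theorem exists_linearIndependent_labelling {κ Z : Type*} [Finite κ] {V : κ → Type*}
    [∀ σ, Fintype (V σ)] (hcard : ∀ σ, Fintype.card (V σ) ≤ 4) (v : ∀ σ, V σ → Z)
    (hv : ∀ σ, Function.Injective (v σ)) (I : Set Z)
    (hI : ∀ σ i j, v σ i ∈ I → v σ j ∈ I → i = j)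
    (A : ∀ σ, V σ → Matrix (Fin 2) (Fin 2) ℂ) (hA : ∀ σ i, A σ i ≠ 0)
    (M : ∀ σ, V σ → Module.End ℝ (Matrix (Fin 2) (Fin 2) ℂ))
    (hM : ∀ σ i, Function.Injective (M σ i)) :
    ∃ p : Z → ℝ, ∀ σ, LinearIndependent ℝ fun i : V σ =>
      if v σ i ∈ I then A σ i else M σ i (coneCurve (p (v σ i))) := by
  -- `S` is the set of labels already placed. Vertices with labels in `I` count as placed from the
  -- start.
  have key : ∀ S : Finset Z, ∃ p : Z → ℝ, ∀ σ, LinearIndepOn ℝ (fun i : V σ =>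
      if v σ i ∈ I then A σ i else M σ i (coneCurve (p (v σ i)))) {i | v σ i ∈ I ∨ v σ i ∈ S} := by
    intro S
    induction S using Finset.induction_on with
    | empty =>
      refine ⟨0, fun σ => ?_⟩
      -- Initially only the fixed vertices are present: at most one in each simplex, with a nonzero
      -- vector.
      have hs : {i | v σ i ∈ I ∨ v σ i ∈ (∅ : Finset Z)}.Subsingleton := by
        intro i hi j hj
        exact hI σ i j (by simpa using hi) (by simpa using hj)
      rcases hs.eq_empty_or_singleton with h | ⟨i, h⟩
      · rw [h]
        exact linearIndepOn_empty ℝ _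
      · rw [h]
        have hi : v σ i ∈ I := by
          have : i ∈ {i | v σ i ∈ I ∨ v σ i ∈ (∅ : Finset Z)} := h ▸ rfl
          simpa using this
        refine LinearIndepOn.singleton ?_
        simpa [hi] using hA σ i
    | insert a S haS ih =>
      obtain ⟨p, hp⟩ := ih
      by_cases haI : a ∈ I
      · refine ⟨p, fun σ => (hp σ).mono ?_⟩
        intro i hi
        rcases hi with hi | hi
        · exact Or.inl hi
        · rcases Finset.mem_insert.1 hi with hi | hi
          · exact Or.inl (hi ▸ haI)
          · exact Or.inr hi
      let old : ∀ σ, Set (V σ) := fun σ => {i | v σ i ∈ I ∨ v σ i ∈ S}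
      let W : ∀ σ, Submodule ℝ (Matrix (Fin 2) (Fin 2) ℂ) := fun σ => Submodule.span ℝ
        ((fun i : V σ => if v σ i ∈ I then A σ i else M σ i (coneCurve (p (v σ i)))) '' old σ)
      -- The parameters to avoid are those which put a vertex labelled `a` into the span of the
      -- vertices already placed in its simplex. Of at most four vertices this one is new, so the
      -- span has dimension at most 3, and each of the finitely many conditions excludes finitely
      -- many parameters.
      have hfin : (⋃ σ, ⋃ i : {i : V σ // v σ i = a},
          {t | coneCurve t ∈ (W σ).comap (M σ i)}).Finite := by
        refine Set.finite_iUnion fun σ => Set.finite_iUnion fun i =>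
          finite_setOf_coneCurve_mem _ ?_
        have h1 : Module.finrank ℝ ((W σ).comap (M σ i)) ≤ Module.finrank ℝ (W σ) := by
          refine LinearMap.finrank_le_finrank_of_injective
            (f := (M σ i).restrict (p := (W σ).comap (M σ i)) (q := W σ) fun x hx => hx) ?_
          intro x y hxy
          exact Subtype.ext (hM σ i (congrArg Subtype.val hxy))
        refine h1.trans ?_
        have h2 : Module.finrank ℝ (W σ) ≤ (old σ).toFinset.card := by
          have h3 : (W σ) = Submodule.span ℝ (((old σ).toFinset.image fun i : V σ =>
              if v σ i ∈ I then A σ i else M σ i (coneCurve (p (v σ i)))) :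
              Finset (Matrix (Fin 2) (Fin 2) ℂ)) := by
            simp [W]
          rw [h3]
          exact (finrank_span_finset_le_card _).trans Finset.card_image_le
        have h4 : (old σ).toFinset.card < Fintype.card (V σ) := by
          refine Finset.card_lt_univ_of_notMem (x := i.1) ?_
          rw [Set.mem_toFinset]
          rintro (h | h)
          · exact haI (i.2 ▸ h)
          · exact haS (i.2 ▸ h)
        have := hcard σ
        omega
      obtain ⟨t, ht⟩ := hfin.exists_notMem
      simp only [Set.mem_iUnion, not_exists] at ht
      refine ⟨Function.update p a t, fun σ => ?_⟩
      have hcongr : LinearIndepOn ℝ (fun i : V σ => if v σ i ∈ I then A σ i else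
          M σ i (coneCurve (Function.update p a t (v σ i)))) (old σ) ∧
          (fun i : V σ => if v σ i ∈ I then A σ i else
          M σ i (coneCurve (Function.update p a t (v σ i)))) '' old σ =
          (fun i : V σ => if v σ i ∈ I then A σ i else M σ i (coneCurve (p (v σ i)))) '' old σ := by
        have he : Set.EqOn (fun i : V σ => if v σ i ∈ I then A σ i else
            M σ i (coneCurve (p (v σ i)))) (fun i : V σ => if v σ i ∈ I then A σ i else
            M σ i (coneCurve (Function.update p a t (v σ i)))) (old σ) := by
          intro i hi
          have hne : v σ i ∈ I ∨ v σ i ≠ a := by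
            rcases hi with h | h
            · exact Or.inl h
            · exact Or.inr fun h' => haS (h' ▸ h)
          rcases hne with h | h
          · simp [h]
          · simp [Function.update_of_ne h]
        exact ⟨(hp σ).congr he, (Set.image_congr he).symm⟩
      -- Labels are injective on a simplex, so at most one vector is added to the old ones.
      by_cases hex : ∃ i, v σ i = a
      · obtain ⟨i, hi⟩ := hex
        have hset : {i | v σ i ∈ I ∨ v σ i ∈ insert a S} = insert i (old σ) := by
          ext j
          simp only [Set.mem_ofPred_eq, Finset.mem_insert, Set.mem_insert_iff, old]
          constructor
          · rintro (h | h | h)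
            · exact Or.inr (Or.inl h)
            · exact Or.inl (hv σ (h.trans hi.symm))
            · exact Or.inr (Or.inr h)
          · rintro (rfl | h | h)
            · exact Or.inr (Or.inl hi)
            · exact Or.inl h
            · exact Or.inr (Or.inr h)
        have hio : i ∉ old σ := by
          rintro (h | h)
          · exact haI (hi ▸ h)
          · exact haS (hi ▸ h)
        rw [hset, linearIndepOn_insert hio, hcongr.2]
        refine ⟨hcongr.1, ?_⟩
        have := ht σ ⟨i, hi⟩
        simpa [hi, haI, W] using this
      · have hset : {i | v σ i ∈ I ∨ v σ i ∈ insert a S} = old σ := by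
          ext j
          have : v σ j ≠ a := fun h => hex ⟨j, h⟩
          simp [old, this]
        rw [hset]
        exact hcongr.1
  have : Finite (Σ σ, V σ) := inferInstance
  have hfin := Set.finite_range fun x : Σ σ, V σ => v x.1 x.2
  obtain ⟨p, hp⟩ := key hfin.toFinset
  refine ⟨p, fun σ => ?_⟩
  have hset : {i | v σ i ∈ I ∨ v σ i ∈ hfin.toFinset} = Set.univ := by
    ext i
    simp only [Set.mem_ofPred_eq, Set.Finite.mem_toFinset, Set.mem_univ, iff_true]
    exact Or.inr ⟨⟨σ, i⟩, rfl⟩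
  have := hp σ
  rw [hset] at this
  exact linearIndepOn_univ_iff.1 this

/-! ## Coverings and locally path-connected subsets -/

section Covering

open Set Topology Filter

/-- A subset is locally path-connected in the sense that its traces on suitable open neighbourhoods
of its points are path-connected. -/
def IsLocallyPathConnectedSet {X : Type*} [TopologicalSpace X] (Z : Set X) : Prop :=
  ∀ x ∈ Z, ∀ O ∈ 𝓝 x, ∃ B ⊆ O, IsOpen B ∧ x ∈ B ∧ IsPathConnected (B ∩ Z)

/-- Supplies local path-connectedness of the universal cover of a manifold, which lifting maps
through the covering requires. -/
theorem IsLocalHomeomorph.locallyPathConnectedSpace {X Y : Type*} [TopologicalSpace X]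
    [TopologicalSpace Y] [LocallyPathConnectedSpace Y] {f : X → Y} (hf : IsLocalHomeomorph f) :
    LocallyPathConnectedSpace X := by
  rw [locallyPathConnectedSpace_iff_pathComponentIn_mem_nhds]
  intro x u hu hxu
  obtain ⟨e, hxe, -⟩ := hf x
  set v := e.target ∩ e.symm ⁻¹' u
  have hv : IsOpen v := e.isOpen_inter_preimage_symm hu
  have hxv : e x ∈ v := ⟨e.map_source hxe, by simpa [e.left_inv hxe] using hxu⟩
  have hsub : pathComponentIn v (e x) ⊆ v := pathComponentIn_subset
  have hpc := isPathConnected_pathComponentIn hxv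
  have h1 : e.symm '' pathComponentIn v (e x) ⊆ pathComponentIn u x := by
    refine (hpc.image' (e.continuousOn_symm.mono (hsub.trans inter_subset_left))).subset_pathComponentIn
      ⟨e x, mem_pathComponentIn_self hxv, e.left_inv hxe⟩ ?_
    rintro _ ⟨y, hy, rfl⟩
    exact (hsub hy).2
  refine mem_of_superset ?_ h1
  have h2 : IsOpen (e.symm '' pathComponentIn v (e x)) :=
    e.isOpen_image_symm_of_subset_target (hv.pathComponentIn _) (hsub.trans inter_subset_left)
  exact h2.mem_nhds ⟨e x, mem_pathComponentIn_self hxv, e.left_inv hxe⟩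

variable {X W : Type*} [TopologicalSpace X] [TopologicalSpace W] {q : W → X}

/-- Every point of the base of a covering has a neighbourhood with sections through all points
above it. -/
theorem IsCoveringMap.exists_sections (hq : IsCoveringMap q) (x : X) :
    ∃ U, IsOpen U ∧ x ∈ U ∧ ∀ w, q w ∈ U → ∃ s : X → W, ContinuousOn s U ∧
      (∀ y ∈ U, q (s y) = y) ∧ s (q w) = w ∧
      ∀ K ⊆ q ⁻¹' U, IsPreconnected K → w ∈ K → ∀ w' ∈ K, s (q w') = w' := by
  obtain ⟨_, U, hxU, hU, hqU, H, hH⟩ := hq x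
  refine ⟨U, hU, hxU, fun w hw => ?_⟩
  classical
  -- The section keeps the fibre coordinate of `w` in the trivialization; its value `w` outside `U`
  -- is irrelevant.
  let s : X → W := fun y => if h : y ∈ U then (H.symm (⟨y, h⟩, (H ⟨w, hw⟩).2)).1 else w
  have hs : ∀ y (h : y ∈ U), s y = (H.symm (⟨y, h⟩, (H ⟨w, hw⟩).2)).1 := fun y h => dif_pos h
  have hc : ContinuousOn s U := by
    rw [continuousOn_iff_continuous_domRestrict]
    have : U.domRestrict s = fun y : U => (H.symm (y, (H ⟨w, hw⟩).2)).1 :=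
      funext fun y => hs y.1 y.2
    rw [this]
    fun_prop
  have hqs : ∀ y ∈ U, q (s y) = y := by
    intro y hy
    rw [hs y hy, ← hH, H.apply_symm_apply]
  have hsw : s (q w) = w := by
    rw [hs _ hw]
    have : ((⟨q w, hw⟩, (H ⟨w, hw⟩).2) : U × _) = H ⟨w, hw⟩ := Prod.ext (Subtype.ext (hH ⟨w, hw⟩).symm) rfl
    rw [this, H.symm_apply_apply]
  refine ⟨s, hc, hqs, hsw, fun K hK hpre hwK w' hw' => ?_⟩
  -- Both maps are lifts of `q` on the connected set `K`, and they agree at `w`.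
  have hEq : EqOn (s ∘ q) id K := by
    refine hq.eqOn_of_comp_eqOn hpre ?_ continuousOn_id ?_ hwK hsw
    · exact hc.comp hq.continuous.continuousOn hK
    · intro v hv
      exact hqs _ (hK hv)
  exact hEq hw'

/-- Components of the preimage of a locally path-connected set are path-connected. -/
theorem IsCoveringMap.joinedIn_of_mem_connectedComponentIn [LocallyPathConnectedSpace W]
    (hq : IsCoveringMap q) {Z : Set X} (hZ : IsLocallyPathConnectedSet Z) {w w' : W}
    (h : w' ∈ connectedComponentIn (q ⁻¹' Z) w) :
    JoinedIn (connectedComponentIn (q ⁻¹' Z) w) w w' := by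
  set A := q ⁻¹' Z
  have hw : w ∈ A := connectedComponentIn_nonempty_iff.1 ⟨w', h⟩
  -- Being joined in `A` is a local property along the connected component: near `a`, a local
  -- section carries the path-connected trace `B ∩ Z` to a path-connected subset of `A` containing
  -- `a` and all nearby points of `A`.
  have hj : JoinedIn A w w' := by
    refine (isPreconnected_connectedComponentIn (F := A) (x := w)).induction₂'
      (fun a b => JoinedIn A a b) (fun a ha => ?_) (fun _ _ _ _ _ _ h h' => h.trans h')
      (mem_connectedComponentIn hw) h
    have haA : a ∈ A := connectedComponentIn_subset _ _ ha
    obtain ⟨U, hU, haU, hsec⟩ := hq.exists_sections (q a)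
    obtain ⟨s, hs, hqs, hsa, hK⟩ := hsec a haU
    obtain ⟨B, hBU, hB, haB, hpc⟩ := hZ (q a) haA U (hU.mem_nhds haU)
    have hO : connectedComponentIn (q ⁻¹' B) a ∈ 𝓝 a :=
      ((hB.preimage hq.continuous).connectedComponentIn).mem_nhds (mem_connectedComponentIn haB)
    filter_upwards [mem_nhdsWithin_of_mem_nhds hO, self_mem_nhdsWithin] with b hb hbA
    have hbA' : b ∈ A := connectedComponentIn_subset _ _ hbA
    have hbB : q b ∈ B := connectedComponentIn_subset (q ⁻¹' B) a hb
    have hsb : s (q b) = b := hK _ ((connectedComponentIn_subset _ _).trans (preimage_mono hBU))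
      isPreconnected_connectedComponentIn (mem_connectedComponentIn haB) b hb
    have himg : IsPathConnected (s '' (B ∩ Z)) :=
      hpc.image' (hs.mono (inter_subset_left.trans hBU))
    have hsub : s '' (B ∩ Z) ⊆ A := by
      rintro _ ⟨y, hy, rfl⟩
      change q (s y) ∈ Z
      rw [hqs y (hBU hy.1)]
      exact hy.2
    have hab := (himg.joinedIn a ⟨q a, ⟨haB, haA⟩, hsa⟩ b ⟨q b, ⟨hbB, hbA'⟩, hsb⟩).mono hsub
    exact ⟨hab, hab.symm⟩
  obtain ⟨p, hp⟩ := hj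
  refine ⟨p, fun t => ?_⟩
  refine (isPreconnected_range p.continuous).subset_connectedComponentIn ⟨0, p.source⟩ ?_ ⟨t, rfl⟩
  rintro _ ⟨t, rfl⟩
  exact hp t

/-- A compact locally path-connected set has a neighbourhood such that different components of its
preimage in a covering lie in different components of the preimage of the neighbourhood. -/
theorem IsCoveringMap.exists_isOpen_separating [T2Space X] [CompactSpace X]
    [LocallyPathConnectedSpace X] (hq : IsCoveringMap q) {Z : Set X} (hZc : IsClosed Z)
    (hZ : IsLocallyPathConnectedSet Z) :
    ∃ U, IsOpen U ∧ Z ⊆ U ∧ ∀ w ∈ q ⁻¹' Z, ∀ w' ∈ q ⁻¹' Z, w' ∈ connectedComponentIn (q ⁻¹' U) w →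
      w' ∈ connectedComponentIn (q ⁻¹' Z) w := by
  have : LocallyPathConnectedSpace W := hq.isLocalHomeomorph.locallyPathConnectedSpace
  let _ : UniformSpace X := uniformSpaceOfCompactR1
  set A := q ⁻¹' Z with hA
  choose O hO hxO hsec using hq.exists_sections
  choose! B hBO hB hxB hpc using fun x (hx : x ∈ Z) => hZ x hx (O x) ((hO x).mem_nhds (hxO x))
  -- A Lebesgue number for the cover of `Z` by the sets `B x`. The smaller entourage `V'` ensures
  -- that two `V'`-small sets which meet, one of them centred in `Z`, fit into a single `B i`.
  obtain ⟨V, hV, hVB⟩ := lebesgue_number_lemma hZc.isCompact (U := fun x : Z => B x.1)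
    (fun x => hB x.1 x.2) (fun x hx => mem_iUnion.2 ⟨⟨x, hx⟩, hxB x hx⟩)
  obtain ⟨V', hV', hsymm, hcomp⟩ := comp_comp_symm_mem_uniformity_sets hV
  let b : X → Set X := fun x => interior (UniformSpace.ball x V')
  have hxb : ∀ x, x ∈ b x := fun x =>
    mem_interior_iff_mem_nhds.2 (UniformSpace.ball_mem_nhds x hV')
  let S : W → Set W := fun w => connectedComponentIn (q ⁻¹' b (q w)) w
  have hS : ∀ w, IsOpen (S w) := fun w =>
    (isOpen_interior.preimage hq.continuous).connectedComponentIn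
  have hwS : ∀ w, w ∈ S w := fun w => mem_connectedComponentIn (hxb (q w))
  have hSb : ∀ w, ∀ u ∈ S w, (q w, q u) ∈ V' := fun w u hu =>
    interior_subset (s := UniformSpace.ball (q w) V')
      (connectedComponentIn_subset (q ⁻¹' b (q w)) w hu)
  -- small neighbourhoods of points of `A` which meet have their centres in the same component
  have hmeet : ∀ x ∈ A, ∀ y ∈ A, ∀ z, z ∈ S x → z ∈ S y →
      connectedComponentIn A x = connectedComponentIn A y := by
    intro x hx y hy z hzx hzy
    obtain ⟨⟨i, hi⟩, hVi⟩ := hVB (q x) hx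
    -- The connected union lies above one `B i`, hence in the image of one section; that section
    -- carries the connected set `B i ∩ Z` to a connected part of `A` containing both `x` and `y`.
    have hsub : S x ∪ S y ⊆ q ⁻¹' B i := by
      rintro u (hu | hu)
      · apply hVi
        exact hcomp ⟨q x, ⟨q x, refl_mem_uniformity hV', refl_mem_uniformity hV'⟩, hSb x u hu⟩
      · apply hVi
        exact hcomp ⟨q y, ⟨q z, hSb x z hzx, hsymm.symm _ _ (hSb y z hzy)⟩, hSb y u hu⟩
    have hpre : IsPreconnected (S x ∪ S y) :=
      IsPreconnected.union z hzx hzy isPreconnected_connectedComponentIn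
        isPreconnected_connectedComponentIn
    obtain ⟨s, hs, hqs, hsx, hK⟩ := hsec i x (hBO i hi (hsub (Or.inl (hwS x))))
    have hsy := hK _ (hsub.trans (preimage_mono (hBO i hi))) hpre (Or.inl (hwS x)) y
      (Or.inr (hwS y))
    have himg : IsPreconnected (s '' (B i ∩ Z)) := ((hpc i hi).isConnected.isPreconnected).image s
      (hs.mono (inter_subset_left.trans (hBO i hi)))
    refine connectedComponentIn_eq (himg.subset_connectedComponentIn
      ⟨q x, ⟨hsub (Or.inl (hwS x)), hx⟩, hsx⟩ ?_ ⟨q y, ⟨hsub (Or.inr (hwS y)), hy⟩, hsy⟩)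
    rintro _ ⟨u, hu, rfl⟩
    change q (s u) ∈ Z
    rw [hqs u (hBO i hi hu.1)]
    exact hu.2
  -- Connectedness and containment in `O x` let a section carry `C x` upstairs, so every point above
  -- `C x` lies in the set `S` of a point above `x`.
  let C : X → Set X := fun x => connectedComponentIn (b x ∩ O x) x
  have hxC : ∀ x, x ∈ C x := fun x => mem_connectedComponentIn ⟨hxb x, hxO x⟩
  refine ⟨⋃ x ∈ Z, C x, isOpen_biUnion fun x _ => (isOpen_interior.inter (hO x)).connectedComponentIn,
    fun x hx => mem_biUnion hx (hxC x), fun w hw w' hw' hww' => ?_⟩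
  set U := ⋃ x ∈ Z, C x
  have hcov : ∀ u ∈ q ⁻¹' U, ∃ x ∈ A, u ∈ S x := by
    intro u hu
    obtain ⟨x, hx, hux⟩ := mem_iUnion₂.1 hu
    have hCO : C x ⊆ b x ∩ O x := connectedComponentIn_subset _ _
    obtain ⟨s, hs, hqs, hsu, -⟩ := hsec x u (hCO hux).2
    have hqsx : q (s x) = x := hqs x (hxO x)
    refine ⟨s x, by simpa [hA, hqsx] using hx, ?_⟩
    have himg : IsPreconnected (s '' C x) := isPreconnected_connectedComponentIn.image s
      (hs.mono (hCO.trans inter_subset_right))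
    refine himg.subset_connectedComponentIn ⟨x, hxC x, rfl⟩ ?_ ⟨q u, hux, hsu⟩
    rintro _ ⟨y, hy, rfl⟩
    change q (s y) ∈ b (q (s x))
    rw [hqsx, hqs y (hCO hy).2]
    exact (hCO hy).1
  have hwU : w ∈ q ⁻¹' U := mem_biUnion hw (hxC (q w))
  -- By `hmeet`, the component of `A` containing the nearby centres is a locally constant function
  -- on the preimage of `U`, hence constant on its components.
  have hP : ∀ x ∈ A, ∀ y ∈ A, w ∈ S x → w' ∈ S y →
      connectedComponentIn A x = connectedComponentIn A y := by
    refine (isPreconnected_connectedComponentIn (F := q ⁻¹' U) (x := w)).induction₂'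
      (fun u v => ∀ x ∈ A, ∀ y ∈ A, u ∈ S x → v ∈ S y →
        connectedComponentIn A x = connectedComponentIn A y) (fun u hu => ?_) ?_
      (mem_connectedComponentIn hwU) hww'
    · obtain ⟨z, hz, huz⟩ := hcov u (connectedComponentIn_subset _ _ hu)
      filter_upwards [mem_nhdsWithin_of_mem_nhds ((hS z).mem_nhds huz)] with v hv
      exact ⟨fun x hx y hy hux hvy => (hmeet x hx z hz u hux huz).trans (hmeet z hz y hy v hv hvy),
        fun x hx y hy hvx huy => (hmeet x hx z hz v hvx hv).trans (hmeet z hz y hy u huz huy)⟩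
    · intro a c d _ hc _ hac hcd x hx y hy hax hdy
      obtain ⟨z, hz, hcz⟩ := hcov c (connectedComponentIn_subset _ _ hc)
      exact (hac x hx z hz hax hcz).trans (hcd z hz y hy hcz hdy)
  rw [hP w hw w' hw' (hwS w) (hwS w')]
  exact mem_connectedComponentIn hw'

end Covering

/-! ## The boundary of a 3-manifold -/

section ManifoldBoundary

open Set Topology

variable {N : Type*} [TopologicalSpace N] [ChartedSpace (EuclideanHalfSpace 3) N]
  [IsManifold (𝓡∂ 3) ∞ N]

theorem isClosed_manifoldBoundary : IsClosed (manifoldBoundary N) :=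
  ModelWithCorners.isClosed_boundary (n := ∞) (by simp)

/-- The boundary is defined by the preferred chart at each point; smooth transition maps respect it,
so any chart of the atlas detects it. -/
theorem mem_manifoldBoundary_iff_chart {e : OpenPartialHomeomorph N (EuclideanHalfSpace 3)}
    (he : e ∈ atlas (EuclideanHalfSpace 3) N) {y : N} (hy : y ∈ e.source) :
    y ∈ manifoldBoundary N ↔ (e y).1 0 = 0 := by
  have h1 : (𝓡∂ 3).IsInteriorPoint y ↔ _ :=
    ModelWithCorners.isInteriorPoint_iff_of_mem_atlas (n := ∞) (by simp) he hy
  have h2 : e.extend (𝓡∂ 3) y ∈ interior (e.extend (𝓡∂ 3)).target ↔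
      e.extend (𝓡∂ 3) y ∈ interior (range (𝓡∂ 3)) :=
    ⟨fun h => interior_mono (e.extend_target_subset_range) h,
      fun h => e.mem_interior_extend_target (e.map_source hy) h⟩
  rw [h2, interior_range_modelWithCornersEuclideanHalfSpace] at h1
  have h3 : y ∈ manifoldBoundary N ↔ ¬ (𝓡∂ 3).IsInteriorPoint y :=
    (ModelWithCorners.isBoundaryPoint_iff_not_isInteriorPoint y)
  rw [h3, h1]
  change ¬ (0 < (e y).1 0) ↔ _
  rw [not_lt]
  exact ⟨fun h => le_antisymm h (e y).2, fun h => h.le⟩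

/-- In a chart, a small ball meets the boundary in its intersection with a plane, which is convex.
-/
theorem isLocallyPathConnectedSet_manifoldBoundary :
    IsLocallyPathConnectedSet (manifoldBoundary N) := by
  intro x hx O hO
  set e := chartAt (EuclideanHalfSpace 3) x
  have hxe : x ∈ e.source := mem_chart_source _ x
  have he := chart_mem_atlas (EuclideanHalfSpace 3) x
  have h1 : e.target ∩ e.symm ⁻¹' (interior O) ∈ 𝓝 (e x) :=
    (e.isOpen_inter_preimage_symm isOpen_interior).mem_nhds
      ⟨e.map_source hxe, by simpa [e.left_inv hxe] using mem_interior_iff_mem_nhds.2 hO⟩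
  obtain ⟨T, hT, hTsub⟩ := mem_nhds_induced Subtype.val _ _ |>.1 h1
  obtain ⟨r, hr, hball⟩ := Metric.mem_nhds_iff.1 hT
  set D : Set (EuclideanHalfSpace 3) := Subtype.val ⁻¹' Metric.ball (e x).1 r
  have hD : IsOpen D := Metric.isOpen_ball.preimage continuous_subtype_val
  have hDsub : D ⊆ e.target ∩ e.symm ⁻¹' (interior O) := (preimage_mono hball).trans hTsub
  have hxD : e x ∈ D := Metric.mem_ball_self hr
  refine ⟨e.source ∩ e ⁻¹' D, ?_, e.isOpen_inter_preimage hD, ⟨hxe, hxD⟩, ?_⟩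
  · rintro y ⟨hy, hyD⟩
    have := (hDsub hyD).2
    rw [mem_preimage, e.left_inv hy] at this
    exact interior_subset this
  have heq : e.source ∩ e ⁻¹' D ∩ manifoldBoundary N = e.symm '' (D ∩ {y | y.1 0 = 0}) := by
    ext y
    constructor
    · rintro ⟨⟨hy, hyD⟩, hyb⟩
      exact ⟨e y, ⟨hyD, (mem_manifoldBoundary_iff_chart he hy).1 hyb⟩, e.left_inv hy⟩
    · rintro ⟨z, ⟨hzD, hz0⟩, rfl⟩
      have hzt := (hDsub hzD).1
      have hzs := e.map_target hzt
      refine ⟨⟨hzs, ?_⟩, (mem_manifoldBoundary_iff_chart he hzs).2 ?_⟩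
      · rw [mem_preimage, e.right_inv hzt]
        exact hzD
      · rw [e.right_inv hzt]
        exact hz0
  rw [heq]
  refine IsPathConnected.image' ?_ (e.continuousOn_symm.mono fun z hz => (hDsub hz.1).1)
  rw [(Topology.IsInducing.mk rfl : Topology.IsInducing
    (Subtype.val : EuclideanHalfSpace 3 → EuclideanSpace ℝ (Fin 3))).isPathConnected_iff]
  have himg : (Subtype.val '' (D ∩ {y : EuclideanHalfSpace 3 | y.1 0 = 0})) =
      Metric.ball (e x).1 r ∩ {y | y 0 = 0} := by
    ext y
    constructor
    · rintro ⟨z, ⟨hzD, hz0⟩, rfl⟩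
      exact ⟨hzD, hz0⟩
    · rintro ⟨hy, hy0⟩
      exact ⟨⟨y, (show y 0 = 0 from hy0).ge⟩, ⟨hy, hy0⟩, rfl⟩
  rw [himg]
  refine Convex.isPathConnected ((convex_ball _ _).inter ?_)
    ⟨(e x).1, Metric.mem_ball_self hr, (mem_manifoldBoundary_iff_chart he hxe).1 hx⟩
  intro a ha b hb s t _ _ _
  simp only [mem_ofPred_eq] at ha hb ⊢
  simp [ha, hb]

end ManifoldBoundary

/-! ## Covering transformations and loops -/

section Deck

open Set Topology

variable {N W : Type*} [TopologicalSpace N] [TopologicalSpace W]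

/-- The group of covering transformations. -/
def deckGroup (q : C(W, N)) : Subgroup (W ≃ₜ W) where
  carrier := {φ | ∀ w, q (φ w) = q w}
  mul_mem' {φ ψ} hφ hψ w := (hφ (ψ w)).trans (hψ w)
  one_mem' _ := rfl
  inv_mem' {φ} hφ w := by
    have := hφ (φ.symm w)
    rw [φ.apply_symm_apply] at this
    exact this.symm

variable {q : C(W, N)}

theorem image_connectedComponentIn_preimage (φ : deckGroup q) (U : Set N) (w : W) :
    φ.1 '' connectedComponentIn (q ⁻¹' U) w = connectedComponentIn (q ⁻¹' U) (φ.1 w) := by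
  by_cases hw : w ∈ q ⁻¹' U
  · rw [φ.1.image_connectedComponentIn hw]
    congr 1
    ext u
    rw [← φ.1.preimage_symm]
    change q ((φ⁻¹ : deckGroup q).1 u) ∈ U ↔ q u ∈ U
    rw [(φ⁻¹).2]
  · have hw' : φ.1 w ∉ q ⁻¹' U := by
      rw [mem_preimage, φ.2]
      exact hw
    rw [connectedComponentIn_eq_empty hw, connectedComponentIn_eq_empty hw', image_empty]

/-- The loop below a path from a point to its image under a covering transformation. -/
def loopOfPath {w₀ : W} (φ : deckGroup q) (p : Path w₀ (φ.1 w₀)) : Path (q w₀) (q w₀) :=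
  (p.map q.continuous).cast rfl (φ.2 w₀).symm

/-- Follow `p` to `w`, then `c` to `φ w`, then the translate of `p` by `φ` backwards to `φ w₀`. The
projection is the conjugate of `b` by the path below `p`, the form of the elements of peripheral
subgroups. -/
theorem isCoveringTransformation_of_paths {w₀ w : W} (φ : deckGroup q) (p : Path w₀ w)
    (c : Path w (φ.1 w)) (b : Path (q w) (q w)) (hb : ∀ t, q (c t) = b t) :
    IsCoveringTransformation q w₀ (MulOpposite.op (FundamentalGroup.fromPath
      (Path.Homotopic.Quotient.mk
        ((p.map q.continuous).trans (b.trans (p.map q.continuous).symm))))) φ.1 := by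
  refine ⟨φ.2, p.trans (c.trans (p.map φ.1.continuous).symm), ?_⟩
  change Path.Homotopic.Quotient.mk _ = Path.Homotopic.Quotient.mk _
  congr 1
  ext t
  simp only [Path.cast_coe, Path.map_coe, Function.comp_apply, Path.trans_apply]
  split_ifs
  · rfl
  · simp [hb]
  · exact φ.2 _

/-- As `W` is simply connected, `q` lifts through itself with any prescribed value over the base
point. The lifts in the two directions are mutually inverse by uniqueness of lifts. -/
theorem exists_deckGroup_apply_eq [SimplyConnectedSpace W] [LocallyPathConnectedSpace W] (hq : IsCoveringMap q) {w w' : W}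
    (h : q w = q w') : ∃ φ : deckGroup q, φ.1 w = w' := by
  obtain ⟨F, ⟨hF, hqF⟩, -⟩ := hq.existsUnique_continuousMap_lifts q w w' h.symm
  obtain ⟨G, ⟨hG, hqG⟩, -⟩ := hq.existsUnique_continuousMap_lifts q w' w h
  have h1 : G ∘ F = id := hq.eq_of_comp_eq (G.continuous.comp F.continuous) continuous_id
    (by rw [← Function.comp_assoc, hqG, hqF]; rfl) w (by simp [hF, hG])
  have h2 : F ∘ G = id := hq.eq_of_comp_eq (F.continuous.comp G.continuous) continuous_id
    (by rw [← Function.comp_assoc, hqF, hqG]; rfl) w' (by simp [hF, hG])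
  exact ⟨⟨⟨⟨F, G, congrFun h1, congrFun h2⟩, F.continuous, G.continuous⟩, congrFun hqF⟩, hF⟩

variable [SimplyConnectedSpace W]

theorem deckGroup.eq_one_of_apply_eq (hq : IsCoveringMap q) (φ : deckGroup q) {w : W}
    (h : φ.1 w = w) : φ = 1 := by
  have h1 : (φ.1 : W → W) = id := hq.eq_of_comp_eq φ.1.continuous continuous_id
    (funext fun w => φ.2 w) w h
  exact Subtype.ext (Homeomorph.ext (congrFun h1))

theorem loopOfPath_homotopic {w₀ : W} (φ : deckGroup q) (p p' : Path w₀ (φ.1 w₀)) :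
    Path.Homotopic.Quotient.mk (loopOfPath φ p) = Path.Homotopic.Quotient.mk (loopOfPath φ p') := by
  have h := (SimplyConnectedSpace.paths_homotopic p p').map q
  rw [← Path.Homotopic.Quotient.eq] at h
  rw [loopOfPath, loopOfPath, Path.Homotopic.Quotient.mk_cast, Path.Homotopic.Quotient.mk_cast]
  exact congrArg (fun x => x.cast rfl (φ.2 w₀).symm) h

/-- The element of the fundamental group which acts as a given covering transformation. -/
noncomputable def deckLoop (w₀ : W) : deckGroup q →* LoopGroup N (q w₀) where
  toFun φ := MulOpposite.op (FundamentalGroup.fromPath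
    (Path.Homotopic.Quotient.mk (loopOfPath φ (PathConnectedSpace.somePath w₀ (φ.1 w₀)))))
  map_one' := congrArg MulOpposite.op
    ((loopOfPath_homotopic (1 : deckGroup q) _ (Path.refl w₀)).trans rfl)
  map_mul' φ ψ := by
    -- The path to `φ w₀` followed by the `φ`-translate of the path to `ψ w₀` lies over the loop of
    -- `φ` followed by that of `ψ`. This is the order of multiplication in `LoopGroup`.
    let r : Path w₀ (φ.1 (ψ.1 w₀)) := (PathConnectedSpace.somePath w₀ (φ.1 w₀)).trans
      ((PathConnectedSpace.somePath w₀ (ψ.1 w₀)).map φ.1.continuous)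
    refine congrArg MulOpposite.op ((loopOfPath_homotopic (φ * ψ) _ r).trans ?_)
    change _ = Path.Homotopic.Quotient.mk (Path.trans _ _)
    congr 1
    ext t
    change q (r t) = _
    simp only [r, loopOfPath, Path.cast_coe, Path.map_coe, Function.comp_apply, Path.trans_apply]
    split_ifs
    · rfl
    · exact φ.2 _

theorem deckLoop_eq {w₀ : W} (φ : deckGroup q) (p : Path w₀ (φ.1 w₀)) :
    deckLoop w₀ φ = MulOpposite.op (FundamentalGroup.fromPath
      (Path.Homotopic.Quotient.mk (loopOfPath φ p))) :=
  congrArg _ (loopOfPath_homotopic φ _ p)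

theorem isCoveringTransformation_deckLoop (w₀ : W) (φ : deckGroup q) :
    IsCoveringTransformation q w₀ (deckLoop w₀ φ) φ.1 :=
  ⟨φ.2, PathConnectedSpace.somePath w₀ (φ.1 w₀), rfl⟩

theorem IsCoveringTransformation.exists_deckLoop_eq {w₀ : W} {γ : LoopGroup N (q w₀)} {φ : W ≃ₜ W}
    (h : IsCoveringTransformation q w₀ γ φ) : ∃ hφ : φ ∈ deckGroup q, deckLoop w₀ ⟨φ, hφ⟩ = γ := by
  obtain ⟨hφ, p, hp⟩ := h
  exact ⟨hφ, (deckLoop_eq ⟨φ, hφ⟩ p).trans (congrArg MulOpposite.op hp)⟩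

/-! ### Peripheral subgroups and stabilizers of components upstairs. -/

theorem mem_peripheralSubgroup_iff {X : Type*} [TopologicalSpace X] {A : Set X} {x e : X}
    (he : e ∈ A) (α : Path x e) (γ : LoopGroup X x) : γ ∈ peripheralSubgroup he α ↔
      ∃ b : Path e e, (∀ t, b t ∈ connectedComponentIn A e) ∧
        γ = MulOpposite.op (FundamentalGroup.fromPath
          (Path.Homotopic.Quotient.mk (α.trans (b.trans α.symm)))) := by
  have key : ∀ b : Path e e, (FundamentalGroup.fundamentalGroupMulEquivOfPath α).symm
      (FundamentalGroup.fromPath (Path.Homotopic.Quotient.mk b)) = FundamentalGroup.fromPath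
        (Path.Homotopic.Quotient.mk (α.trans (b.trans α.symm))) := fun b => rfl
  constructor
  · rintro ⟨_, ⟨β, rfl⟩, hβ⟩
    induction β using Path.Homotopic.Quotient.ind with
    | mk β =>
      refine ⟨β.map continuous_subtype_val, fun t => (β t).2, ?_⟩
      exact congrArg MulOpposite.op hβ.symm
  · rintro ⟨b, hb, rfl⟩
    let β : Path (⟨e, mem_connectedComponentIn he⟩ : connectedComponentIn A e)
        ⟨e, mem_connectedComponentIn he⟩ :=
      { toFun := fun t => ⟨b t, hb t⟩
        continuous_toFun := by fun_prop
        source' := by simp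
        target' := by simp }
    exact ⟨_, ⟨FundamentalGroup.fromPath (Path.Homotopic.Quotient.mk β), rfl⟩, key b⟩

/-- A covering transformation which preserves a component of the preimage of `A` acts as an element
of a peripheral subgroup. -/
theorem deckLoop_mem_peripheralSubgroup {A : Set N} {w₀ w : W} (hw : q w ∈ A) (p : Path w₀ w)
    (φ : deckGroup q) (h : JoinedIn (connectedComponentIn (q ⁻¹' A) w) w (φ.1 w)) :
    deckLoop w₀ φ ∈ peripheralSubgroup hw (p.map q.continuous) := by
  obtain ⟨c, hc⟩ := h
  let b : Path (q w) (q w) := (c.map q.continuous).cast rfl (φ.2 w).symm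
  obtain ⟨hφ, e⟩ := (isCoveringTransformation_of_paths φ p c b fun t => rfl).exists_deckLoop_eq
  refine (mem_peripheralSubgroup_iff hw _ _).2 ⟨b, fun t => ?_, e⟩
  refine (isPreconnected_connectedComponentIn.image q q.continuous.continuousOn
    ).subset_connectedComponentIn ⟨w, mem_connectedComponentIn hw, rfl⟩ ?_ ⟨c t, hc t, rfl⟩
  rintro _ ⟨u, hu, rfl⟩
  exact connectedComponentIn_subset (q ⁻¹' A) w hu

/-- The elements of a peripheral subgroup act as covering transformations which preserve a component
of the preimage. -/
theorem exists_lift_of_peripheralSubgroup [LocallyPathConnectedSpace W] (hq : IsCoveringMap q)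
    {A : Set N} {w₀ : W} {e : N} (he : e ∈ A) (α : Path (q w₀) e) :
    ∃ w, q w = e ∧ ∀ γ ∈ peripheralSubgroup he α, ∃ φ, IsCoveringTransformation q w₀ γ φ ∧
      φ w ∈ connectedComponentIn (q ⁻¹' A) w := by
  have h0 : α.toContinuousMap 0 = q w₀ := α.source
  obtain ⟨w, p, hp⟩ : ∃ w, ∃ p : Path w₀ w, ∀ t, q (p t) = α t :=
    ⟨_, ⟨hq.liftPath α w₀ h0, hq.liftPath_zero .., rfl⟩, congrFun (hq.liftPath_lifts α w₀ h0)⟩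
  obtain rfl : q w = e := by
    have := hp 1
    rwa [p.target, α.target] at this
  obtain rfl : p.map q.continuous = α := Path.ext (funext hp)
  refine ⟨w, rfl, fun γ hγ => ?_⟩
  obtain ⟨b, hb, rfl⟩ := (mem_peripheralSubgroup_iff he _ _).1 hγ
  have hb0 : b.toContinuousMap 0 = q w := b.source
  -- The lift of a loop in the end stays in the preimage of `A`, so the covering transformation
  -- taking `w` to its endpoint preserves the component of `w`.
  obtain ⟨w', c, hc⟩ : ∃ w', ∃ c : Path w w', ∀ t, q (c t) = b t :=
    ⟨_, ⟨hq.liftPath b w hb0, hq.liftPath_zero .., rfl⟩, congrFun (hq.liftPath_lifts b w hb0)⟩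
  have hw' : q w = q w' := by
    have := hc 1
    rw [c.target, b.target] at this
    exact this.symm
  obtain ⟨φ, rfl⟩ := exists_deckGroup_apply_eq hq hw'
  refine ⟨φ.1, isCoveringTransformation_of_paths φ p c b hc, ?_⟩
  refine (isPreconnected_range c.continuous).subset_connectedComponentIn ⟨0, c.source⟩ ?_
    ⟨1, c.target⟩
  rintro _ ⟨t, rfl⟩
  change q (c t) ∈ A
  rw [hc]
  exact connectedComponentIn_subset A (q w) (hb t)

end Deck

/-! ## The completed universal cover -/

section Completion

open Set Topology

namespace EndCompactification

variable {N : Type*} [TopologicalSpace N] [ChartedSpace (EuclideanHalfSpace 3) N]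

theorem mk_eq_mk_iff {x y : N} :
    mk x = mk y ↔ x = y ∨ y ∈ connectedComponentIn (manifoldBoundary N) x :=
  Quotient.eq (r := collapseSetoid (manifoldBoundary N))

theorem mk_mem_idealPoints_iff {x : N} : mk x ∈ idealPoints N ↔ x ∈ manifoldBoundary N := by
  constructor
  · rintro ⟨y, hy, h⟩
    rcases mk_eq_mk_iff.1 h with rfl | h
    · exact hy
    · exact connectedComponentIn_subset _ _ h
  · exact fun h => ⟨x, h, rfl⟩

theorem eq_of_mk_eq_mk {x y : N} (hx : x ∉ manifoldBoundary N) (h : mk x = mk y) : x = y := by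
  rcases mk_eq_mk_iff.1 h with h | h
  · exact h
  · exact absurd (connectedComponentIn_nonempty_iff.1 ⟨y, h⟩) hx

/-- Such sets are saturated for the collapsing relation. The two kinds serve as neighbourhoods of
ideal points and of other points respectively. -/
theorem preimage_mk_image {U : Set N}
    (hU : manifoldBoundary N ⊆ U ∨ Disjoint U (manifoldBoundary N)) : mk ⁻¹' (mk '' U) = U := by
  refine Subset.antisymm ?_ (subset_preimage_image _ _)
  rintro x ⟨y, hy, h⟩
  rcases mk_eq_mk_iff.1 h with rfl | hx
  · exact hy
  · rcases hU with hU | hU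
    · exact hU (connectedComponentIn_subset _ _ hx)
    · exact absurd (connectedComponentIn_nonempty_iff.1 ⟨x, hx⟩) (disjoint_left.1 hU hy)

theorem isOpen_image_mk {U : Set N} (hUo : IsOpen U)
    (hU : manifoldBoundary N ⊆ U ∨ Disjoint U (manifoldBoundary N)) : IsOpen (mk '' U) := by
  change IsOpen (mk ⁻¹' (mk '' U))
  rwa [preimage_mk_image hU]

end EndCompactification

namespace CoverCompletion

variable {N W : Type*} [TopologicalSpace N] [ChartedSpace (EuclideanHalfSpace 3) N]
  [TopologicalSpace W] {q : C(W, N)}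

theorem mk_surjective : Function.Surjective (mk q) := Quotient.mk_surjective

theorem mk_eq_mk_iff {w w' : W} :
    mk q w = mk q w' ↔ w = w' ∨ w' ∈ connectedComponentIn (q ⁻¹' manifoldBoundary N) w :=
  Quotient.eq (r := collapseSetoid (q ⁻¹' manifoldBoundary N))

theorem proj_mk (w : W) : proj q (mk q w) = EndCompactification.mk (q w) := rfl

/-- The basic neighbourhoods. -/
theorem isOpen_image_mk {U : Set N} (hUo : IsOpen U)
    (hU : manifoldBoundary N ⊆ U ∨ Disjoint U (manifoldBoundary N)) (w : W) :
    IsOpen (mk q '' connectedComponentIn (q ⁻¹' U) w) := by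
  refine TopologicalSpace.isOpen_generateFrom_of_mem
    ⟨_, EndCompactification.isOpen_image_mk hUo hU, w, ?_⟩
  have : (fun v => EndCompactification.mk (q v)) ⁻¹' (EndCompactification.mk '' U) = q ⁻¹' U :=
    congrArg (q ⁻¹' ·) (EndCompactification.preimage_mk_image hU)
  rw [this]

/-- Over an evenly covered set without boundary points, a local section inverts the projection. At a
lifted end injectivity may fail, because nearby points can be permuted by the stabilizer. -/
theorem exists_isOpen_injOn [T2Space N] [IsManifold (𝓡∂ 3) ∞ N] (hq : IsCoveringMap q)
    {x : CoverCompletion q} (hx : proj q x ∉ EndCompactification.idealPoints N) :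
    ∃ S, IsOpen S ∧ x ∈ S ∧ InjOn (proj q) S := by
  obtain ⟨w, rfl⟩ := mk_surjective x
  rw [proj_mk, EndCompactification.mk_mem_idealPoints_iff] at hx
  obtain ⟨U, hU, hwU, hsec⟩ := hq.exists_sections (q w)
  obtain ⟨s, -, -, -, hK⟩ := hsec w hwU
  have hO : IsOpen (U \ manifoldBoundary N) := hU.sdiff isClosed_manifoldBoundary
  refine ⟨_, isOpen_image_mk hO (Or.inr disjoint_sdiff_left) w,
    ⟨w, mem_connectedComponentIn ⟨hwU, hx⟩, rfl⟩, ?_⟩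
  have hsub : connectedComponentIn (q ⁻¹' (U \ manifoldBoundary N)) w ⊆
    q ⁻¹' (U \ manifoldBoundary N) := connectedComponentIn_subset _ _
  have hs := hK _ (hsub.trans (preimage_mono sdiff_subset)) isPreconnected_connectedComponentIn
    (mem_connectedComponentIn ⟨hwU, hx⟩)
  rintro _ ⟨a, ha, rfl⟩ _ ⟨b, hb, rfl⟩ h
  rw [proj_mk, proj_mk] at h
  rw [← hs a ha, ← hs b hb, EndCompactification.eq_of_mk_eq_mk (hsub ha).2 h]

/-- Distinct lifts of an end are separated by components over the neighbourhood from
`exists_isOpen_separating`, and distinct lifts of an interior point by sheets. Separation within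
fibres is all that comparing two lifts requires. -/
theorem exists_disjoint_isOpen [T2Space N] [CompactSpace N] [IsManifold (𝓡∂ 3) ∞ N]
    (hq : IsCoveringMap q) {x y : CoverCompletion q} (hxy : x ≠ y) (h : proj q x = proj q y) :
    ∃ S T, IsOpen S ∧ IsOpen T ∧ x ∈ S ∧ y ∈ T ∧ Disjoint S T := by
  by_cases hx : proj q x ∈ EndCompactification.idealPoints N
  · have : LocallyPathConnectedSpace N :=
      ChartedSpace.locallyPathConnectedSpace (EuclideanHalfSpace 3) N
    obtain ⟨U, hU, hZU, hsep⟩ := hq.exists_isOpen_separating isClosed_manifoldBoundary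
      (isLocallyPathConnectedSet_manifoldBoundary (N := N))
    have hy := h ▸ hx
    obtain ⟨a, rfl⟩ := mk_surjective x
    obtain ⟨b, rfl⟩ := mk_surjective y
    rw [proj_mk, EndCompactification.mk_mem_idealPoints_iff] at hx hy
    refine ⟨_, _, isOpen_image_mk hU (Or.inl hZU) a, isOpen_image_mk hU (Or.inl hZU) b,
      ⟨a, mem_connectedComponentIn (hZU hx), rfl⟩, ⟨b, mem_connectedComponentIn (hZU hy), rfl⟩, ?_⟩
    rw [disjoint_left]
    rintro _ ⟨c, hc, rfl⟩ ⟨d, hd, hcd⟩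
    have hdc : c ∈ connectedComponentIn (q ⁻¹' U) d := by
      rcases mk_eq_mk_iff.1 hcd with rfl | hdc
      · exact mem_connectedComponentIn (connectedComponentIn_subset _ _ hc)
      · exact connectedComponentIn_mono _ (preimage_mono hZU) hdc
    have hab : b ∈ connectedComponentIn (q ⁻¹' U) a := by
      rw [connectedComponentIn_eq hc, ← connectedComponentIn_eq hdc, ← connectedComponentIn_eq hd]
      exact mem_connectedComponentIn (hZU hy)
    exact hxy (mk_eq_mk_iff.2 (Or.inr (hsep a hx b hy hab)))
  · obtain ⟨w, rfl⟩ := mk_surjective x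
    obtain ⟨w', rfl⟩ := mk_surjective y
    rw [proj_mk, EndCompactification.mk_mem_idealPoints_iff] at hx
    rw [proj_mk, proj_mk] at h
    have hww := EndCompactification.eq_of_mk_eq_mk hx h
    obtain ⟨U, hU, hwU, hsec⟩ := hq.exists_sections (q w)
    have hO : IsOpen (U \ manifoldBoundary N) := hU.sdiff isClosed_manifoldBoundary
    have hd : Disjoint (U \ manifoldBoundary N) (manifoldBoundary N) := disjoint_sdiff_left
    have hwO : w ∈ q ⁻¹' (U \ manifoldBoundary N) := ⟨hwU, hx⟩
    have hwO' : w' ∈ q ⁻¹' (U \ manifoldBoundary N) := by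
      rw [mem_preimage, ← hww]
      exact hwO
    refine ⟨_, _, isOpen_image_mk hO (Or.inr hd) w, isOpen_image_mk hO (Or.inr hd) w',
      ⟨w, mem_connectedComponentIn hwO, rfl⟩, ⟨w', mem_connectedComponentIn hwO', rfl⟩, ?_⟩
    rw [disjoint_left]
    rintro _ ⟨c, hc, rfl⟩ ⟨d, hd', hcd⟩
    have hdO := connectedComponentIn_subset _ _ hd'
    obtain rfl : d = c := by
      rcases mk_eq_mk_iff.1 hcd with h1 | h1
      · exact h1
      · exact absurd (connectedComponentIn_nonempty_iff.1 ⟨c, h1⟩) hdO.2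
    obtain ⟨s, -, -, hsw, hK⟩ := hsec w hwU
    have hw'c : w' ∈ connectedComponentIn (q ⁻¹' (U \ manifoldBoundary N)) w := by
      rw [connectedComponentIn_eq hc, ← connectedComponentIn_eq hd']
      exact mem_connectedComponentIn hwO'
    have := hK _ ((connectedComponentIn_subset _ _).trans (preimage_mono sdiff_subset))
      isPreconnected_connectedComponentIn (mem_connectedComponentIn hwO) w' hw'c
    rw [← hww, hsw] at this
    exact hxy (congrArg _ this)

/-! ### Uniqueness of lifts -/

theorem _root_.dense_openSimplex {ι : Type*} [Fintype ι] [Nonempty ι] : Dense (openSimplex ι) := by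
  intro t
  have h0 : ∀ n : ℕ, 0 < 1 / ((n : ℝ) + 1) := fun n => by positivity
  have h1 : ∀ n : ℕ, 1 / ((n : ℝ) + 1) ≤ 1 := fun n => by
    rw [div_le_one (by positivity)]
    linarith [(Nat.cast_nonneg n : (0 : ℝ) ≤ n)]
  -- Points of the segment to the barycentre, whose coordinates are all positive, converging to `t`.
  let x : ℕ → stdSimplex ℝ ι := fun n =>
    ⟨(1 - 1 / ((n : ℝ) + 1)) • t.1 + (1 / ((n : ℝ) + 1)) • (stdSimplex.barycenter : stdSimplex ℝ ι).1,
      convex_stdSimplex ℝ ι t.2 (stdSimplex.barycenter : stdSimplex ℝ ι).2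
        (sub_nonneg.2 (h1 n)) (h0 n).le (by ring)⟩
  refine mem_closure_of_tendsto (f := x) (b := Filter.atTop) ?_ (Filter.Eventually.of_forall ?_)
  · rw [tendsto_subtype_rng]
    have h := tendsto_one_div_add_atTop_nhds_zero_nat (𝕜 := ℝ)
    have h2 := ((tendsto_const_nhds (x := (1 : ℝ))).sub h).smul (tendsto_const_nhds (x := t.1))
    have h3 := h2.add (h.smul (tendsto_const_nhds (x := (stdSimplex.barycenter : stdSimplex ℝ ι).1)))
    simp only [sub_zero, one_smul, zero_smul, add_zero] at h3
    exact h3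
  · intro n i
    have h2 : 0 < ((Fintype.card ι : ℝ))⁻¹ := inv_pos.2 (by exact_mod_cast Fintype.card_pos)
    exact add_pos_of_nonneg_of_pos (mul_nonneg (sub_nonneg.2 (h1 n)) (t.2.1 i)) (mul_pos (h0 n) h2)

theorem _root_.isPreconnected_openSimplex {ι : Type*} [Fintype ι] : IsPreconnected (openSimplex ι) := by
  rw [← Topology.IsInducing.subtypeVal.isPreconnected_image]
  have : Subtype.val '' openSimplex ι = {f : ι → ℝ | ∀ i, 0 < f i} ∩ stdSimplex ℝ ι := by
    ext f
    constructor
    · rintro ⟨t, ht, rfl⟩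
      exact ⟨ht, t.2⟩
    · rintro ⟨hf, hf'⟩
      exact ⟨⟨f, hf'⟩, hf, rfl⟩
  rw [this]
  refine (Convex.inter ?_ (convex_stdSimplex ℝ ι)).isPreconnected
  have h2 : {f : ι → ℝ | ∀ i, 0 < f i} = univ.pi fun _ => Ioi 0 := by ext; simp
  rw [h2]
  exact convex_pi fun _ _ => convex_Ioi 0

theorem isClosed_setOf_lift_eq [T2Space N] [CompactSpace N] [IsManifold (𝓡∂ 3) ∞ N]
    (hq : IsCoveringMap q) {Y : Type*} [TopologicalSpace Y] {f g : Y → CoverCompletion q}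
    (hf : Continuous f) (hg : Continuous g) (h : ∀ y, proj q (f y) = proj q (g y)) :
    IsClosed {y | f y = g y} := by
  rw [← isOpen_compl_iff, isOpen_iff_mem_nhds]
  intro y hy
  obtain ⟨S, T, hS, hT, hyS, hyT, hd⟩ := exists_disjoint_isOpen hq hy (h y)
  filter_upwards [(hS.preimage hf).mem_nhds hyS, (hT.preimage hg).mem_nhds hyT] with z hzS hzT hz
  exact disjoint_left.1 hd hzS (by rw [show f z = g z from hz]; exact hzT)

theorem _root_.mem_openSimplex_of_subsingleton {ι : Type*} [Fintype ι] [Subsingleton ι]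
    (t : stdSimplex ℝ ι) : t ∈ openSimplex ι := by
  intro i
  have h1 : ∑ j, t j = 1 := t.2.2
  rw [Fintype.sum_subsingleton _ i] at h1
  rw [h1]
  exact one_pos

/-- Open cells of positive dimension contain no ideal points. -/
theorem _root_.TameTriangulation.char_notMem_idealPoints (T : TameTriangulation N)
    {σ : T.complex.Cell} (hσ : Fintype.card (T.complex.Vert σ) ≠ 1)
    {t : stdSimplex ℝ (T.complex.Vert σ)} (ht : t ∈ openSimplex (T.complex.Vert σ)) :
    T.complex.char σ t ∉ EndCompactification.idealPoints N := by
  intro hi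
  obtain ⟨τ, hτ, u, hu⟩ := T.idealPoints_subset hi
  have huniq := T.complex.existsUnique_cell (T.complex.char σ t)
  have := Fintype.card_le_one_iff_subsingleton.1 hτ.le
  exact hσ (huniq.unique ⟨t, ht, rfl⟩ ⟨u, mem_openSimplex_of_subsingleton u, hu⟩ ▸ hτ)

/-- Two lifts of a characteristic map which agree at one point of the open simplex are equal. -/
theorem lift_unique [T2Space N] [CompactSpace N] [IsManifold (𝓡∂ 3) ∞ N]
    (hq : IsCoveringMap q) (T : TameTriangulation N) (σ : T.complex.Cell)
    {f g : C(stdSimplex ℝ (T.complex.Vert σ), CoverCompletion q)}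
    (hf : ∀ t, proj q (f t) = T.complex.char σ t) (hg : ∀ t, proj q (g t) = T.complex.char σ t)
    {t₀ : stdSimplex ℝ (T.complex.Vert σ)} (ht₀ : t₀ ∈ openSimplex (T.complex.Vert σ))
    (h : f t₀ = g t₀) : f = g := by
  by_cases hσ : Fintype.card (T.complex.Vert σ) = 1
  · have := Fintype.card_le_one_iff_subsingleton.1 hσ.le
    ext t
    rw [Subsingleton.elim t t₀, h]
  have hfg : ∀ t, proj q (f t) = proj q (g t) := fun t => (hf t).trans (hg t).symm
  have hni := fun t ht => T.char_notMem_idealPoints hσ (t := t) ht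
  have hcl := isClosed_setOf_lift_eq hq f.continuous g.continuous hfg
  -- The open simplex contains no ideal points, so the locus of agreement is open there by local
  -- injectivity, closed by `hcl`, and nonempty. Density then gives agreement on the closed simplex,
  -- including its ideal vertices.
  have hEq : ∀ t ∈ openSimplex (T.complex.Vert σ), f t = g t := by
    intro t ht
    refine isPreconnected_openSimplex.induction₂' (fun a b => f a = g a → f b = g b)
      (fun a ha => ?_) (fun _ _ _ _ _ _ h1 h2 h3 => h2 (h1 h3)) ht₀ ht h
    by_cases hfa : f a = g a
    · obtain ⟨S, hS, haS, hinj⟩ := exists_isOpen_injOn hq (x := f a) (by rw [hf]; exact hni a ha)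
      filter_upwards [mem_nhdsWithin_of_mem_nhds ((hS.preimage f.continuous).mem_nhds haS),
        mem_nhdsWithin_of_mem_nhds ((hS.preimage g.continuous).mem_nhds
          (show g a ∈ S from hfa ▸ haS))] with b hb hb'
      have := hinj hb hb' (hfg b)
      exact ⟨fun _ => this, fun _ => hfa⟩
    · filter_upwards [mem_nhdsWithin_of_mem_nhds (hcl.isOpen_compl.mem_nhds hfa)] with b hb
      exact ⟨fun h => absurd h hfa, fun h => absurd h hb⟩
  ext t
  exact (hcl.closure_subset_iff.2 hEq) (dense_openSimplex t)

/-! ### The action of the covering transformations -/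

/-- The homeomorphism induced by a covering transformation, as a map. -/
def deckMap (φ : deckGroup q) : CoverCompletion q → CoverCompletion q :=
  Quotient.map' φ.1 (by
    rintro a b (rfl | h)
    · exact Or.inl rfl
    · right
      rw [← image_connectedComponentIn_preimage]
      exact ⟨b, h, rfl⟩)

noncomputable instance : MulAction (deckGroup q) (CoverCompletion q) where
  smul := deckMap
  one_smul x := by
    obtain ⟨w, rfl⟩ := mk_surjective x
    rfl
  mul_smul φ ψ x := by
    obtain ⟨w, rfl⟩ := mk_surjective x
    rfl

theorem smul_mk (φ : deckGroup q) (w : W) : φ • mk q w = mk q (φ.1 w) := rfl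

theorem proj_smul (φ : deckGroup q) (x : CoverCompletion q) : proj q (φ • x) = proj q x := by
  obtain ⟨w, rfl⟩ := mk_surjective x
  rw [smul_mk, proj_mk, proj_mk, φ.2]

theorem continuous_smul (φ : deckGroup q) : Continuous fun x : CoverCompletion q => φ • x := by
  refine continuous_generateFrom_iff.2 ?_
  rintro _ ⟨U, hU, w, rfl⟩
  refine TopologicalSpace.isOpen_generateFrom_of_mem ⟨U, hU, (φ⁻¹).1 w, ?_⟩
  have h := image_connectedComponentIn_preimage φ⁻¹ (EndCompactification.mk ⁻¹' U) w
  change φ⁻¹.1 '' connectedComponentIn ((fun v => EndCompactification.mk (q v)) ⁻¹' U) w =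
    connectedComponentIn ((fun v => EndCompactification.mk (q v)) ⁻¹' U) (φ⁻¹.1 w) at h
  rw [← h]
  ext x
  constructor
  · rintro ⟨c, hc, hcx⟩
    refine ⟨_, ⟨c, hc, rfl⟩, ?_⟩
    rw [← smul_mk, hcx, inv_smul_smul]
  · rintro ⟨_, ⟨c, hc, rfl⟩, rfl⟩
    refine ⟨c, hc, ?_⟩
    rw [← smul_mk]
    exact (smul_inv_smul φ _).symm

end CoverCompletion

end Completion

/-! ## Existence of developing maps -/

section Existence

open Set Topology CoverCompletion

variable {N W : Type*} [TopologicalSpace N] [ChartedSpace (EuclideanHalfSpace 3) N]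
  [TopologicalSpace W] {q : C(W, N)} {w₀ : W}

/-- A point of a simplex whose coordinates outside a face vanish lies on the face. -/
theorem exists_stdSimplex_map_eq {U V : Type*} [Fintype U] [Fintype V] {f : U → V}
    (hf : Function.Injective f) (t : stdSimplex ℝ V) (ht : ∀ i ∉ range f, t i = 0) :
    ∃ t' : stdSimplex ℝ U, stdSimplex.map f t' = t ∧ ∀ j, t' j = t (f j) := by
  classical
  refine ⟨⟨fun j => t (f j), fun j => t.2.1 _, ?_⟩, ?_, fun j => rfl⟩
  · rw [Fintype.sum_of_injective f hf (fun j => t (f j)) t ht fun _ => rfl]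
    exact t.2.2
  · apply Subtype.ext
    funext i
    change (FunOnFinite.linearMap ℝ ℝ f fun j => t (f j)) i = t i
    rw [FunOnFinite.linearMap_apply_apply]
    by_cases hi : i ∈ range f
    · obtain ⟨j, rfl⟩ := hi
      rw [Finset.sum_eq_single j] <;> simp [hf.eq_iff]
    · rw [ht i hi]
      exact Finset.sum_eq_zero fun j hj => absurd ⟨j, (Finset.mem_filter.1 hj).2⟩ hi

/-- `χ` is a lift of the characteristic map of the cell `σ`. -/
def IsCellLift (T : TameTriangulation N) (σ : T.complex.Cell)
    (χ : C(stdSimplex ℝ (T.complex.Vert σ), CoverCompletion q)) : Prop :=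
  ∀ t, proj q (χ t) = T.complex.char σ t

/-- The translate of a lift. -/
noncomputable def smulLift (φ : deckGroup q) {Y : Type*} [TopologicalSpace Y] (χ : C(Y, CoverCompletion q)) :
    C(Y, CoverCompletion q) := ⟨fun t => φ • χ t, (continuous_smul φ).comp χ.continuous⟩

theorem IsCellLift.smulLift {T : TameTriangulation N} {σ : T.complex.Cell}
    {χ : C(stdSimplex ℝ (T.complex.Vert σ), CoverCompletion q)} (h : IsCellLift T σ χ)
    (φ : deckGroup q) : IsCellLift T σ (smulLift φ χ) := fun t =>
  (proj_smul φ (χ t)).trans (h t)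

open Classical in
/-- The map which is straight on the lifted cells with given light-cone vectors over the
vertices. -/
theorem exists_straight_extension [T2Space N] [CompactSpace N] [IsManifold (𝓡∂ 3) ∞ N]
    (hq : IsCoveringMap q) (T : TameTriangulation N)
    (H : CoverCompletion q → Matrix (Fin 2) (Fin 2) ℂ) :
    ∃ D : CoverCompletion q → ClosedHyperbolic3,
      (∀ σ χ, IsCellLift T σ χ → ∀ t,
        D (χ t) = idealSimplex (fun i => H (χ (stdSimplex.vertex i))) t) ∧
      ∀ x, (∀ σ χ, IsCellLift T σ χ → ∀ t, χ t ≠ x) → D x = rayPoint (H x) := by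
  -- The value at `x` is prescribed by the lifted cell with `x` in its open simplex. The cell and
  -- the parameter are determined downstairs, the lift by `lift_unique`. Points on no lifted cell
  -- get the ray of `H x`, so existence of lifts is never needed.
  have h0 : ∀ x : CoverCompletion q, ∃ y : ClosedHyperbolic3,
      (∀ σ χ, IsCellLift T σ χ → ∀ t ∈ openSimplex (T.complex.Vert σ), χ t = x →
        y = idealSimplex (fun i => H (χ (stdSimplex.vertex i))) t) ∧
      ((∀ σ χ, IsCellLift T σ χ → ∀ t, χ t ≠ x) → y = rayPoint (H x)) := by
    intro x
    by_cases hx : ∃ σ χ, IsCellLift T σ χ ∧ ∃ t ∈ openSimplex (T.complex.Vert σ), χ t = x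
    · obtain ⟨σ, χ, hχ, t, ht, htx⟩ := hx
      refine ⟨idealSimplex (fun i => H (χ (stdSimplex.vertex i))) t, ?_,
        fun h => absurd htx (h σ χ hχ t)⟩
      intro σ' χ' hχ' t' ht' htx'
      have e : T.complex.char σ t = T.complex.char σ' t' := by
        rw [← hχ, ← hχ', htx, htx']
      obtain rfl : σ = σ' := (T.complex.existsUnique_cell (T.complex.char σ t)).unique
        ⟨t, ht, rfl⟩ ⟨t', ht', e.symm⟩
      obtain rfl : t = t' := T.complex.injOn_char σ ht ht' e
      obtain rfl : χ = χ' := lift_unique hq T σ hχ hχ' ht (htx.trans htx'.symm)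
      rfl
    · push Not at hx
      exact ⟨rayPoint (H x), fun σ χ hχ t ht htx => absurd htx (hx σ χ hχ t ht), fun _ => rfl⟩
  choose D hD hD' using h0
  refine ⟨D, fun σ χ hχ t => ?_, hD'⟩
  -- the face whose open simplex contains the point
  have hne : {i | t i ≠ 0}.Nonempty := by
    by_contra h
    rw [not_nonempty_iff_eq_empty] at h
    have h1 : ∑ i, t i = 1 := t.2.2
    rw [Finset.sum_eq_zero fun i _ => by
      by_contra hi
      exact (h ▸ (show i ∈ {i | t i ≠ 0} from hi) : i ∈ (∅ : Set _))] at h1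
    exact zero_ne_one h1
  obtain ⟨τ, f, hf, hfr, hfc⟩ := T.complex.exists_face σ _ hne
  have hoff : ∀ i ∉ range f, t i = 0 := fun i hi => by
    rw [hfr] at hi
    exact not_not.1 hi
  obtain ⟨t', hmap, ht't⟩ := exists_stdSimplex_map_eq hf t hoff
  have ht' : t' ∈ openSimplex (T.complex.Vert τ) := by
    intro j
    refine lt_of_le_of_ne (t'.2.1 _) (Ne.symm ?_)
    rw [ht't]
    exact (hfr ▸ mem_range_self j : f j ∈ {i | t i ≠ 0})
  let χ' : C(stdSimplex ℝ (T.complex.Vert τ), CoverCompletion q) :=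
    χ.comp ⟨stdSimplex.map f, stdSimplex.continuous_map f⟩
  have hχ' : IsCellLift T τ χ' := fun u => (hχ _).trans (hfc u).symm
  -- The prescription on the face agrees with that on the whole simplex, since the vertices off the
  -- face contribute zero to the sum.
  rw [hD (χ t) τ χ' hχ' t' ht' (congrArg χ hmap)]
  refine congrArg rayPoint ?_
  refine (Fintype.sum_of_injective f hf _ _ (fun i hi => ?_) fun j => ?_)
  · rw [hoff i hi, zero_smul]
  · change t' j • H (χ (stdSimplex.map f (stdSimplex.vertex j))) = _
    rw [stdSimplex.map_vertex, ht't]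

/-! ### Equivariant light-cone vectors and the developing map. -/

variable [SimplyConnectedSpace W]

theorem deckGroup.eq_one_of_smul_eq (hq : IsCoveringMap q) {φ : deckGroup q} {x : CoverCompletion q}
    (hx : proj q x ∉ EndCompactification.idealPoints N) (h : φ • x = x) : φ = 1 := by
  obtain ⟨w, rfl⟩ := mk_surjective x
  rw [proj_mk, EndCompactification.mk_mem_idealPoints_iff] at hx
  rw [smul_mk] at h
  rcases CoverCompletion.mk_eq_mk_iff.1 h with h | h
  · exact deckGroup.eq_one_of_apply_eq hq φ h
  · have := connectedComponentIn_nonempty_iff.1 ⟨w, h⟩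
    rw [mem_preimage, φ.2] at this
    exact absurd this hx

/-- The stabilizer of an ideal point fixes a light-cone vector. -/
theorem IsBoundaryParabolic.exists_lightCone_of_ideal [IsManifold (𝓡∂ 3) ∞ N]
    [LocallyPathConnectedSpace W] (hq : IsCoveringMap q) {ρ : LoopGroup N (q w₀) →* PSL(2, ℂ)}
    (hρ : IsBoundaryParabolic ρ) {x : CoverCompletion q}
    (hx : proj q x ∈ EndCompactification.idealPoints N) :
    ∃ A ∈ lightCone, ∀ φ : deckGroup q, φ • x = x → pslConj (ρ (deckLoop w₀ φ)) A = A := by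
  obtain ⟨w, rfl⟩ := mk_surjective x
  rw [proj_mk, EndCompactification.mk_mem_idealPoints_iff] at hx
  let p := PathConnectedSpace.somePath w₀ w
  obtain ⟨A, hA, hfix⟩ := (hρ (q w) hx (p.map q.continuous)).exists_lightCone
  refine ⟨A, hA, fun φ hφ => hfix _ ⟨_, ?_, rfl⟩⟩
  -- A transformation fixing `x` maps `w` into its own boundary component, where a path joins the
  -- two points; so it acts as an element of the peripheral subgroup along the path below `p`.
  refine deckLoop_mem_peripheralSubgroup hx p φ
    (hq.joinedIn_of_mem_connectedComponentIn isLocallyPathConnectedSet_manifoldBoundary ?_)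
  rw [smul_mk] at hφ
  rcases CoverCompletion.mk_eq_mk_iff.1 hφ.symm with h | h
  · rw [← h]
    exact mem_connectedComponentIn hx
  · exact h

/-- Equivariant choices of light-cone vectors at the ideal points, and of group elements at the
other points. -/
theorem IsBoundaryParabolic.exists_equivariant [IsManifold (𝓡∂ 3) ∞ N]
    [LocallyPathConnectedSpace W] (hq : IsCoveringMap q) {ρ : LoopGroup N (q w₀) →* PSL(2, ℂ)}
    (hρ : IsBoundaryParabolic ρ) :
    ∃ (A : CoverCompletion q → Matrix (Fin 2) (Fin 2) ℂ) (g : CoverCompletion q → PSL(2, ℂ)),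
      (∀ x, A x ∈ lightCone) ∧
      (∀ (φ : deckGroup q) x, proj q x ∈ EndCompactification.idealPoints N →
        A (φ • x) = pslConj (ρ (deckLoop w₀ φ)) (A x)) ∧
      (∀ (φ : deckGroup q) x, proj q x ∉ EndCompactification.idealPoints N →
        g (φ • x) = ρ (deckLoop w₀ φ) * g x) := by
  have h0 : ∀ x : CoverCompletion q, ∃ A ∈ lightCone,
      proj q x ∈ EndCompactification.idealPoints N →
        ∀ φ : deckGroup q, φ • x = x → pslConj (ρ (deckLoop w₀ φ)) A = A := by
    intro x
    by_cases hx : proj q x ∈ EndCompactification.idealPoints N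
    · obtain ⟨A, hA, h⟩ := hρ.exists_lightCone_of_ideal hq hx
      exact ⟨A, hA, fun _ => h⟩
    · exact ⟨coneCurve 0, coneCurve_mem_lightCone 0, fun h => absurd h hx⟩
  choose A₀ hA₀ hfix using h0
  let r : CoverCompletion q → CoverCompletion q := fun x =>
    Quotient.out (Quotient.mk (MulAction.orbitRel (deckGroup q) (CoverCompletion q)) x)
  have hr : ∀ x, ∃ φ : deckGroup q, φ • r x = x := by
    intro x
    have : (MulAction.orbitRel (deckGroup q) (CoverCompletion q)).r x (r x) :=
      Setoid.symm' _ (Quotient.mk_out (s := MulAction.orbitRel (deckGroup q) (CoverCompletion q)) x)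
    exact this
  have hrs : ∀ (φ : deckGroup q) x, r (φ • x) = r x := by
    intro φ x
    refine congrArg Quotient.out (Quotient.sound ?_)
    exact ⟨φ, rfl⟩
  choose τ hτ using hr
  have hproj : ∀ x, proj q (r x) = proj q x := by
    intro x
    conv_rhs => rw [← hτ x]
    rw [proj_smul]
  -- The transformations `φ * τ x` and `τ (φ • x)` both carry the representative `r x` to `φ • x`,
  -- so they differ by a stabilizer. At ideal points this fixes the vector `A₀ (r x)`; elsewhere it
  -- is trivial.
  have hstab : ∀ (φ : deckGroup q) x, ((φ * τ x)⁻¹ * τ (φ • x)) • r x = r x := by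
    intro φ x
    have h1 := hτ (φ • x)
    rw [hrs] at h1
    rw [mul_smul, h1, mul_inv_rev, mul_smul, inv_smul_smul, inv_smul_eq_iff, hτ]
  refine ⟨fun x => pslConj (ρ (deckLoop w₀ (τ x))) (A₀ (r x)), fun x => ρ (deckLoop w₀ (τ x)),
    fun x => pslConj_mem_lightCone _ (hA₀ _), fun φ x hx => ?_, fun φ x hx => ?_⟩
  · rw [← hproj] at hx
    have h1 := hfix (r x) hx _ (hstab φ x)
    have h2 : τ (φ • x) = φ * τ x * ((φ * τ x)⁻¹ * τ (φ • x)) := by group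
    change pslConj (ρ (deckLoop w₀ (τ (φ • x)))) (A₀ (r (φ • x))) = _
    rw [hrs, h2, map_mul, map_mul, map_mul, Module.End.mul_apply, h1, map_mul, map_mul, map_mul,
      Module.End.mul_apply]
  · rw [← hproj] at hx
    have h1 := deckGroup.eq_one_of_smul_eq hq hx (hstab φ x)
    change ρ (deckLoop w₀ (τ (φ • x))) = _
    rw [← inv_mul_eq_one.1 h1, map_mul, map_mul]

variable [T2Space N] [CompactSpace N] [IsManifold (𝓡∂ 3) ∞ N]

/-- Covering transformations are transitive on fibres over non-ideal points, and such a point in the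
open simplex determines the lift. Cells with one vertex are excluded because they may be ideal. -/
theorem IsCellLift.exists_smulLift_eq [LocallyPathConnectedSpace W] (hq : IsCoveringMap q)
    {T : TameTriangulation N} {σ : T.complex.Cell} (hσ : Fintype.card (T.complex.Vert σ) ≠ 1)
    {χ χ' : C(stdSimplex ℝ (T.complex.Vert σ), CoverCompletion q)} (h : IsCellLift T σ χ)
    (h' : IsCellLift T σ χ') : ∃ φ : deckGroup q, _root_.smulLift φ χ = χ' := by
  obtain ⟨t, ht⟩ : (openSimplex (T.complex.Vert σ)).Nonempty := dense_openSimplex.nonempty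
  have hni := T.char_notMem_idealPoints hσ ht
  obtain ⟨w, hw⟩ := mk_surjective (χ t)
  obtain ⟨w', hw'⟩ := mk_surjective (χ' t)
  have e : proj q (χ t) = proj q (χ' t) := (h t).trans (h' t).symm
  rw [← h t, ← hw, proj_mk, EndCompactification.mk_mem_idealPoints_iff] at hni
  rw [← hw, ← hw', proj_mk, proj_mk] at e
  obtain ⟨φ, hφ⟩ := exists_deckGroup_apply_eq hq (EndCompactification.eq_of_mk_eq_mk hni e)
  refine ⟨φ, lift_unique hq T σ (h.smulLift φ) h' ht ?_⟩
  change φ • χ t = χ' t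
  rw [← hw, ← hw', smul_mk, hφ]

open Classical in
/-- An equivariant choice of light-cone vectors which is in general position on the lifted cells. -/
theorem IsBoundaryParabolic.exists_generic_equivariant [LocallyPathConnectedSpace W]
    (hq : IsCoveringMap q) {ρ : LoopGroup N (q w₀) →* PSL(2, ℂ)} (hρ : IsBoundaryParabolic ρ)
    (T : TameTriangulation N) (hT : T.SeparatesVertices) :
    ∃ H : CoverCompletion q → Matrix (Fin 2) (Fin 2) ℂ, (∀ x, H x ∈ lightCone) ∧
      (∀ (φ : deckGroup q) x, H (φ • x) = pslConj (ρ (deckLoop w₀ φ)) (H x)) ∧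
      ∀ σ χ, IsCellLift T σ χ → LinearIndependent ℝ fun i => H (χ (stdSimplex.vertex i)) := by
  obtain ⟨A, g, hA, hAφ, hgφ⟩ := hρ.exists_equivariant hq
  have := T.complex.finite_cell
  let κ := {σ : T.complex.Cell //
    ∃ χ : C(stdSimplex ℝ (T.complex.Vert σ), CoverCompletion q), IsCellLift T σ χ}
  choose χ₀ hχ₀ using fun σ : κ => σ.2
  -- The labels are the vertices downstairs, so the parameter of a vertex is the same for all its
  -- lifts and equivariance is kept; one lift `χ₀` of each cell suffices, the others being
  -- translates.
  obtain ⟨p, hp⟩ := exists_linearIndependent_labelling (κ := κ)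
    (V := fun σ => T.complex.Vert σ.1) (fun σ => T.complex.card_vert_le σ.1)
    (fun σ i => T.complex.char σ.1 (stdSimplex.vertex i)) (fun σ => (hT σ.1).1)
    (EndCompactification.idealPoints N) (fun σ => (hT σ.1).2)
    (fun σ i => A (χ₀ σ (stdSimplex.vertex i))) (fun σ i => (hA _).2.1)
    (fun σ i => pslConj (g (χ₀ σ (stdSimplex.vertex i)))) (fun σ i => pslConj_injective _)
  let H : CoverCompletion q → Matrix (Fin 2) (Fin 2) ℂ := fun x =>
    if proj q x ∈ EndCompactification.idealPoints N then A x
    else pslConj (g x) (coneCurve (p (proj q x)))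
  have hH : ∀ x, H x ∈ lightCone := by
    intro x
    by_cases hx : proj q x ∈ EndCompactification.idealPoints N
    · simp only [H, if_pos hx]
      exact hA x
    · simp only [H, if_neg hx]
      exact pslConj_mem_lightCone _ (coneCurve_mem_lightCone _)
  have hHφ : ∀ (φ : deckGroup q) x, H (φ • x) = pslConj (ρ (deckLoop w₀ φ)) (H x) := by
    intro φ x
    by_cases hx : proj q x ∈ EndCompactification.idealPoints N
    · simp only [H, proj_smul, if_pos hx]
      exact hAφ φ x hx
    · simp only [H, proj_smul, if_neg hx]
      rw [hgφ φ x hx, map_mul, Module.End.mul_apply]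
  refine ⟨H, hH, hHφ, fun σ χ hχ => ?_⟩
  -- For a single vertex independence only says that its light-cone vector is nonzero.
  by_cases hσ : Fintype.card (T.complex.Vert σ) = 1
  · have := Fintype.card_le_one_iff_subsingleton.1 hσ.le
    refine Fintype.linearIndependent_iff.2 fun a ha i => ?_
    rw [Fintype.sum_subsingleton _ i] at ha
    exact (smul_eq_zero.1 ha).resolve_right (hH _).2.1
  · let σ' : κ := ⟨σ, χ, hχ⟩
    obtain ⟨φ, hφ⟩ := IsCellLift.exists_smulLift_eq hq hσ (hχ₀ σ') hχ
    have h1 := hp σ'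
    have h2 : (fun i => H (χ (stdSimplex.vertex i))) =
        pslConj (ρ (deckLoop w₀ φ)) ∘ fun i => H (χ₀ σ' (stdSimplex.vertex i)) := by
      rw [← hφ]
      exact funext fun i => hHφ φ _
    rw [h2]
    refine LinearIndependent.map' ?_ _ (LinearMap.ker_eq_bot.2 (pslConj_injective _))
    simp only [H, hχ₀ σ' _]
    exact h1

/-- A boundary-parabolic representation has a developing map for every triangulation which
separates its vertices. -/
theorem exists_isDevelopingMap (hq : IsCoveringMap q) {ρ : LoopGroup N (q w₀) →* PSL(2, ℂ)}
    (hρ : IsBoundaryParabolic ρ) (T : TameTriangulation N) (hT : T.SeparatesVertices) :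
    ∃ D : CoverCompletion q → ClosedHyperbolic3, IsDevelopingMap T ρ D := by
  classical
  have : LocallyPathConnectedSpace N :=
    ChartedSpace.locallyPathConnectedSpace (EuclideanHalfSpace 3) N
  have : LocallyPathConnectedSpace W := hq.isLocalHomeomorph.locallyPathConnectedSpace
  obtain ⟨H, hH, hHφ, hli⟩ := hρ.exists_generic_equivariant hq T hT
  obtain ⟨D, hD, hD'⟩ := exists_straight_extension hq T H
  have hequiv : ∀ (φ : deckGroup q) x, D (φ • x) = ρ (deckLoop w₀ φ) • D x := by
    intro φ x
    by_cases hx : ∃ σ χ, IsCellLift T σ χ ∧ ∃ t, χ t = x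
    · obtain ⟨σ, χ, hχ, t, rfl⟩ := hx
      have h1 := hD σ _ (hχ.smulLift φ) t
      change D (φ • χ t) = _ at h1
      rw [h1, hD σ χ hχ]
      have hv := fun i => hH (χ (stdSimplex.vertex i))
      refine Eq.trans ?_ (rayPoint_pslConj _ (sum_smul_posSemidef hv t.2.1)
        (sum_smul_ne_zero hv t))
      rw [map_sum]
      refine congrArg rayPoint ?_
      refine Finset.sum_congr rfl fun i _ => ?_
      rw [map_smul]
      exact congrArg _ (hHφ φ _)
    · push Not at hx
      rw [hD' x hx, hD' (φ • x), hHφ, rayPoint_pslConj _ (hH x).1 (hH x).2.1]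
      intro σ χ hχ t ht
      exact hx σ _ (hχ.smulLift φ⁻¹) t (by
        change φ⁻¹ • χ t = x
        rw [ht, inv_smul_smul])
  refine ⟨D, ?_, ?_, ?_⟩
  · intro γ φ hγ w
    obtain ⟨hφ, rfl⟩ := hγ.exists_deckLoop_eq
    exact hequiv ⟨φ, hφ⟩ (CoverCompletion.mk q w)
  · rintro x ⟨σ, hσ, t, ht⟩
    have := Fintype.card_le_one_iff_subsingleton.1 hσ.le
    -- A zero-cell is a single point, so the constant map at `x` is a lift of it and `D x` is the
    -- image of a vertex.
    have hχ : IsCellLift T σ (ContinuousMap.const _ x) := fun u => by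
      rw [Subsingleton.elim u t, ht]
      rfl
    have h1 := hD σ _ hχ t
    rw [ContinuousMap.const_apply] at h1
    obtain ⟨i⟩ := T.complex.nonempty_vert σ
    rw [h1, Subsingleton.elim t (stdSimplex.vertex i), idealSimplex_vertex]
    exact rayPoint_mem_boundary (hH _)
  · intro σ χ hχ
    rw [show (fun t => D (χ t)) = idealSimplex fun i => H (χ (stdSimplex.vertex i)) from
      funext (hD σ χ hχ)]
    exact isIdealHomeomorphism_idealSimplex (fun i => hH _) (hli σ χ hχ)

end Existence

/-! ## Barycentric subdivisions separate vertices -/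

section Subdivision

open Set

open Classical in
theorem baryMap_vertex_apply {V : Type*} [Fintype V] {c : Finset (Finset V)}
    [DecidableEq c] (hc : ∀ F ∈ c, F.Nonempty) (F : c) (v : V) :
    (baryMap c hc (stdSimplex.vertex F)) v = if v ∈ F.1 then (F.1.card : ℝ)⁻¹ else 0 := by
  change baryFun c (Pi.single F 1) v = _
  unfold baryFun
  rw [Finset.sum_eq_single F]
  · simp
  · intro G _ hG
    simp [hG]
  · simp

/-- The barycentre of a face lies in the open cell of the face. -/
theorem SimplexComplex.exists_cell_barycentre {X : Type*} [TopologicalSpace X]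
    (K : SimplexComplex X) (σ : K.Cell) {c : Finset (Finset (K.Vert σ))}
    [DecidableEq c] (hc : ∀ F ∈ c, F.Nonempty) (F : c) :
    ∃ τ, Fintype.card (K.Vert τ) = F.1.card ∧
      K.char σ (baryMap c hc (stdSimplex.vertex F)) ∈ K.char τ '' openSimplex (K.Vert τ) := by
  obtain ⟨τ, f, hf, hfr, hfc⟩ := K.exists_face σ (F.1 : Set (K.Vert σ))
    (by exact_mod_cast hc F.1 F.2)
  obtain ⟨t', hmap, ht'⟩ := exists_stdSimplex_map_eq hf (baryMap c hc (stdSimplex.vertex F))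
    fun i hi => by
      rw [hfr, Finset.mem_coe] at hi
      rw [baryMap_vertex_apply, if_neg hi]
  refine ⟨τ, ?_, t', fun j => ?_, by rw [hfc, hmap]⟩
  · rw [← Set.ncard_coe_finset, ← hfr, ← Set.image_univ, Set.ncard_image_of_injective _ hf,
      Set.ncard_univ, Nat.card_eq_fintype_card]
  · have hj : f j ∈ F.1 := by
      rw [← Finset.mem_coe, ← hfr]
      exact mem_range_self j
    rw [ht', baryMap_vertex_apply, if_pos hj]
    have := (hc F.1 F.2).card_pos
    positivity

theorem eq_of_isChain_of_card_eq {V : Type*} {c : Finset (Finset V)}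
    (hc : IsChain (· ⊆ ·) (c : Set (Finset V))) {F G : c} (h : F.1.card = G.1.card) : F = G := by
  rcases hc.total F.2 G.2 with h' | h'
  · exact Subtype.ext (Finset.eq_of_subset_of_card_le h' h.ge)
  · exact Subtype.ext (Finset.eq_of_subset_of_card_le h' h.le).symm

/-- The vertices of a simplex of the subdivision are barycentres of faces of different dimensions in
a flag. They lie in open cells of those dimensions, hence are distinct. An ideal point is a
zero-cell, and a flag contains at most one face with a single vertex. -/
theorem TameTriangulation.separatesVertices_barycentricSubdivision {N : Type*} [TopologicalSpace N]
    [ChartedSpace (EuclideanHalfSpace 3) N] (T : TameTriangulation N) :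
    T.barycentricSubdivision.SeparatesVertices := by
  rintro ⟨σ, c, hc⟩
  let _ : DecidableEq c := fun F G => Classical.propDecidable (F = G)
  let x : c → EndCompactification N := fun F =>
    T.complex.char σ (baryMap c hc.2.1 (stdSimplex.vertex F))
  have key : ∀ F, ∃ τ, Fintype.card (T.complex.Vert τ) = F.1.card ∧
      x F ∈ T.complex.char τ '' openSimplex (T.complex.Vert τ) :=
    T.complex.exists_cell_barycentre σ hc.2.1
  constructor
  · intro F G h
    obtain ⟨τ, hτ, hF⟩ := key F
    obtain ⟨τ', hτ', hG⟩ := key G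
    rw [← show x F = x G from h] at hG
    obtain rfl := (T.complex.existsUnique_cell _).unique hF hG
    exact eq_of_isChain_of_card_eq hc.2.2 (hτ.symm.trans hτ')
  · have hcard : ∀ F, x F ∈ EndCompactification.idealPoints N → F.1.card = 1 := by
      intro F hF
      obtain ⟨υ, hυ, t, ht⟩ := T.idealPoints_subset hF
      obtain ⟨τ, hτ, hFτ⟩ := key F
      have := Fintype.card_le_one_iff_subsingleton.1 hυ.le
      obtain rfl := (T.complex.existsUnique_cell _).unique hFτ
        ⟨t, mem_openSimplex_of_subsingleton t, ht⟩
      rw [← hτ, hυ]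
    intro F G hF hG
    exact eq_of_isChain_of_card_eq hc.2.2 ((hcard F hF).trans (hcard G hG).symm)

end Subdivision

/-! ## Uniqueness and the main theorem -/

section Main

open Set

variable {N W : Type*} [TopologicalSpace N] [ChartedSpace (EuclideanHalfSpace 3) N]
  [TopologicalSpace W] {q : C(W, N)} {w₀ : W}

theorem isBoundaryParabolic_one : IsBoundaryParabolic (1 : LoopGroup N (q w₀) →* PSL(2, ℂ)) := by
  intro e he α
  obtain ⟨z, hz⟩ := boundary_nonempty
  refine ⟨z, hz, ?_⟩
  rintro _ ⟨γ, -, rfl⟩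
  exact ⟨one_smul _ z, fun h => absurd rfl h⟩

/-- Developing maps agree at the lifts of nontrivial ends. -/
theorem developingMapsEquivalent [SimplyConnectedSpace W] [LocallyPathConnectedSpace W]
    (hq : IsCoveringMap q) (T : TameTriangulation N) {ρ : LoopGroup N (q w₀) →* PSL(2, ℂ)}
    (hρ : IsBoundaryParabolic ρ) {D D' : CoverCompletion q → ClosedHyperbolic3}
    (hD : IsDevelopingMap T ρ D) (hD' : IsDevelopingMap T ρ D') :
    DevelopingMapsEquivalent ρ D D' := by
  rintro w hw ⟨α, hα⟩
  obtain ⟨w₁, hw₁, hlift⟩ := exists_lift_of_peripheralSubgroup hq hw α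
  obtain ⟨⟨g, hg⟩, hg1⟩ := Subgroup.ne_bot_iff_exists_ne_one.1 hα
  replace hg1 : g ≠ 1 := fun h => hg1 (Subtype.ext h)
  obtain ⟨z, -, hz⟩ := hρ (q w) hw α
  obtain ⟨y, -, huniq⟩ := (hz g hg).2 hg1
  obtain ⟨γ, hγ, hγg⟩ := hg
  obtain ⟨φ, hφ, hφw⟩ := hlift γ hγ
  have hmk : CoverCompletion.mk q (φ w₁) = CoverCompletion.mk q w₁ :=
    (CoverCompletion.mk_eq_mk_iff.2 (Or.inr hφw)).symm
  have hzero : CoverCompletion.proj q (CoverCompletion.mk q w₁) ∈ T.complex.zeroCells :=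
    T.idealPoints_subset ⟨q w₁, hw₁ ▸ hw, rfl⟩
  -- The transformation `φ` fixes the ideal point of `w₁`, so by equivariance its image is fixed by
  -- the parabolic `g`, whose only fixed point at infinity is `y`.
  have hfix : ∀ E : CoverCompletion q → ClosedHyperbolic3, IsDevelopingMap T ρ E →
      E (CoverCompletion.mk q w₁) = y := by
    intro E hE
    refine huniq _ ⟨hE.zeroCell _ hzero, ?_⟩
    rw [← hγg]
    exact (hE.equivariant γ φ hφ w₁).symm.trans (congrArg E hmk)
  -- The point `w₁` is only one lift of the boundary point; equivariance carries the agreement to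
  -- the given lift `w`.
  obtain ⟨ψ, hψ⟩ := exists_deckGroup_apply_eq hq hw₁
  have h := isCoveringTransformation_deckLoop w₀ ψ
  rw [← hψ, hD.equivariant _ _ h, hD'.equivariant _ _ h, hfix D hD, hfix D' hD']

end Main

theorem mainTheorem12 {N : Type*} [TopologicalSpace N] [T2Space N] [CompactSpace N]
    [ConnectedSpace N] [ChartedSpace (EuclideanHalfSpace 3) N] [IsManifold (𝓡∂ 3) ∞ N]
    {W : Type*} [TopologicalSpace W] [SimplyConnectedSpace W]
    (q : C(W, N)) (hq : IsCoveringMap q) (w₀ : W) :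
    -- existence: every triangulation becomes fine enough by (repeated) barycentric subdivision
    (∀ T : TameTriangulation N, ∃ m : ℕ, ∀ n ≥ m,
      ∀ ρ : LoopGroup N (q w₀) →* PSL(2, ℂ), IsBoundaryParabolic ρ →
        ∃ D : CoverCompletion q → ClosedHyperbolic3,
          IsDevelopingMap (TameTriangulation.barycentricSubdivision^[n] T) ρ D) ∧
    -- existence: a triangulation is fine enough as soon as it separates its vertices
    (∀ T : TameTriangulation N, T.SeparatesVertices →
      ∀ ρ : LoopGroup N (q w₀) →* PSL(2, ℂ), IsBoundaryParabolic ρ →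
        ∃ D : CoverCompletion q → ClosedHyperbolic3, IsDevelopingMap T ρ D) ∧
    -- uniqueness up to equivalence
    (∀ (T : TameTriangulation N) (ρ : LoopGroup N (q w₀) →* PSL(2, ℂ)), IsBoundaryParabolic ρ →
      ∀ D D' : CoverCompletion q → ClosedHyperbolic3,
        IsDevelopingMap T ρ D → IsDevelopingMap T ρ D' → DevelopingMapsEquivalent ρ D D') ∧
    -- a single barycentric subdivision suffices for all boundary-parabolic representations
    (∀ (T : TameTriangulation N) (ρ : LoopGroup N (q w₀) →* PSL(2, ℂ)), IsBoundaryParabolic ρ →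
      ∃ D : CoverCompletion q → ClosedHyperbolic3,
        IsDevelopingMap T.barycentricSubdivision ρ D) ∧
    -- and the trivial representation is one of them
    IsBoundaryParabolic (1 : LoopGroup N (q w₀) →* PSL(2, ℂ)) := by
  have : LocallyPathConnectedSpace N :=
    ChartedSpace.locallyPathConnectedSpace (EuclideanHalfSpace 3) N
  have : LocallyPathConnectedSpace W := hq.isLocalHomeomorph.locallyPathConnectedSpace
  refine ⟨fun T => ⟨1, fun n hn ρ hρ => ?_⟩, fun T hT ρ hρ => exists_isDevelopingMap hq hρ T hT,
    fun T ρ hρ D D' hD hD' => developingMapsEquivalent hq T hρ hD hD',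
    fun T ρ hρ => exists_isDevelopingMap hq hρ _ T.separatesVertices_barycentricSubdivision,
    isBoundaryParabolic_one⟩
  -- With `m = 1`, an `n`-fold subdivision with `n ≥ m` is itself the barycentric subdivision of a
  -- triangulation, so it separates vertices.
  obtain ⟨n, rfl⟩ := Nat.exists_eq_add_of_le' hn
  rw [Function.iterate_succ_apply']
  exact exists_isDevelopingMap hq hρ _
    (TameTriangulation.separatesVertices_barycentricSubdivision _)
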